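/- **Definitions.** Maps are written on the right. *Regular $*$-semigroups.* A regular $*$-semigroup is a semigroup $S$ with a unary operation $a\mapsto a^*$ satisfying $(a^*)^*=a=aa^*a$ and $(ab)^*=b^*a^*$ for all $a,b\in S$. Let $\mathbf{RSS}$ be the category of regular $*$-semigroups, whose morphisms are the maps preserving the product and ${}^*$. *Projection algebras.* A projection algebra is a set $P$ with unary operations $\theta_p$ ($p\in P$) such that, for all $p,q\in P$: $p\theta_p=p$, $\theta_p\theta_p=\theta_p$, $p\theta_q\theta_p=q\theta_p$, $\theta_p\theta_q\theta_p=\theta_{q\theta_p}$ and $\theta_p\theta_q\theta_p\theta_q=\theta_p\theta_q$. It is partially ordered by $p\le q\iff p=p\theta_q$, and we write $p\mathrel{\mathscr F}q$ if $p=q\theta_p$ and $q=p\theta_q$. A morphism $\phi:P\to P'$ is a map with $(p\theta_q)\phi=(p\phi)\theta'_{q\phi}$ for all $p,q\in P$. *Chains.* A $P$-path is a tuple $(p_1,\dots,p_k)$, $k\ge1$, with $p_1\mathrel{\mathscr F}\cdots\mathrel{\mathscr F}p_k$; it has domain $p_1$ and range $p_k$. Paths are composed by $(p_1,\dots,p_k)\circ(p_k,q_2,\dots,q_l)=(p_1,\dots,p_k,q_2,\dots,q_l)$.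 The left restriction of $(p_1,\dots,p_k)$ to $q\le p_1$ is $(q_1,\dots,q_k)$, where $q_1=q$ and $q_i=q_{i-1}\theta_{p_i}$ for $i\ge 2$. The chain groupoid $\mathscr C(P)$ is the quotient of the category of $P$-paths by the congruence generated by the pairs $((p,p),(p))$ for $p\in P$, and $((p,q,p),(p))$ for $p\mathrel{\mathscr F}q$. The class of $(p_1,\dots,p_k)$ is denoted $[p_1,\dots,p_k]$, and $\mathfrak c\le\mathfrak d$ means that some path in $\mathfrak c$ is a left restriction of some path in $\mathfrak d$. *Ordered groupoids.* A small category is identified with its set of morphisms, and its objects with its identities. The domain and range of $a$ are $\mathbf d(a)$ and $\mathbf r(a)$, and $a\circ b$ is defined iff $\mathbf r(a)=\mathbf d(b)$. An ordered groupoid is a small groupoid $\mathcal G$ with a partial order on its morphisms that is preserved by $\mathbf d$, $\mathbf r$, inversion and (where defined) composition, such that for every $a\in\mathcal G$ and every object $p\le\mathbf d(a)$ there is a unique $u\le a$ with $\mathbf d(u)=p$. This $u$ is denoted ${}_p{\downharpoonleft}a$; for an object $q\le\mathbf r(a)$ we write $a{\downharpoonright}_q=({}_q{\downharpoonleft}a^{-1})^{-1}$.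 *Chained projection groupoids.* A chained projection groupoid is a triple $(P,\mathcal G,\varepsilon)$ such that: 1. $\mathcal G$ is an ordered groupoid, $P$ is a projection algebra whose underlying set is the object set of $\mathcal G$, and the order of $\mathcal G$ restricts on $P$ to the order of the projection algebra. 2. For $a\in\mathcal G$ let $\Theta_a:P\to P$, $p\Theta_a=\mathbf r({}_{p'}{\downharpoonleft}a)$ where $p'=p\theta_{\mathbf d(a)}$. Then $\theta_{p\Theta_a}=\Theta_{a^{-1}}\theta_p\Theta_a$ for all $a\in\mathcal G$ and $p\in P$. 3. $\varepsilon:\mathscr C(P)\to\mathcal G$ is an order-preserving functor with $\varepsilon[p]=p$ for all $p\in P$. 4. Let $b\in\mathcal G$, $q=\mathbf d(b)$, $r=\mathbf r(b)$, and let $e,f\in P$ satisfy $f=e\Theta_b\theta_f$ and $e=f\Theta_{b^{-1}}\theta_e$. Put $e_1=e\theta_q$, $e_2=f\Theta_{b^{-1}}$, $f_1=e\Theta_b$ and $f_2=f\theta_r$. Then $$\varepsilon[e,e_1]\circ{}_{e_1}{\downharpoonleft}b\circ\varepsilon[f_1,f]=\varepsilon[e,e_2]\circ b{\downharpoonright}_{f_2}\circ\varepsilon[f_2,f]$$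 (all these composites are defined). A chained projection functor $(P,\mathcal G,\varepsilon)\to(P',\mathcal G',\varepsilon')$ is an order-preserving functor $\phi:\mathcal G\to\mathcal G'$ that restricts to a projection algebra morphism $P\to P'$ and satisfies $(\varepsilon[p_1,\dots,p_k])\phi=\varepsilon'[p_1\phi,\dots,p_k\phi]$ for every $P$-path $(p_1,\dots,p_k)$. Let $\mathbf{CPG}$ be the category of chained projection groupoids and chained projection functors. *The constructions.* For a regular $*$-semigroup $S$ let $\mathbf G(S)=(P(S),\mathcal G(S),\varepsilon(S))$, where - $P(S)=\{p\in S:p^2=p=p^*\}$ with $q\theta_p=pqp$; - $\mathcal G(S)$ has morphism set $S$, object set $P(S)$, $\mathbf d(a)=aa^*$, $\mathbf r(a)=a^*a$, $a\circ b=ab$ whenever $\mathbf r(a)=\mathbf d(b)$, $a^{-1}=a^*$, and $a\le b$ iff $a=pb$ for some $p\in P(S)$ with $p\le\mathbf d(b)$; - $\varepsilon(S)[p_1,\dots,p_k]=p_1\cdots p_k$. For a chained projection groupoid $(P,\mathcal G,\varepsilon)$ let $\mathbf S(P,\mathcal G,\varepsilon)$ be the set $\mathcal G$ with $a^*=a^{-1}$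 and the product $$a\bullet b=a{\downharpoonright}_{p'}\circ\varepsilon[p',q']\circ{}_{q'}{\downharpoonleft}b,\qquad p=\mathbf r(a),\ q=\mathbf d(b),\ p'=q\theta_p,\ q'=p\theta_q.$$ **Theorem.** For every regular $*$-semigroup $S$, $\mathbf G(S)$ is a chained projection groupoid, and every $*$-homomorphism $S\to S'$ is a chained projection functor $\mathbf G(S)\to\mathbf G(S')$. For every chained projection groupoid $X$, $\mathbf S(X)$ is a regular $*$-semigroup, and every chained projection functor $X\to X'$ is a $*$-homomorphism $\mathbf S(X)\to\mathbf S(X')$. Thus $\mathbf G:\mathbf{RSS}\to\mathbf{CPG}$ and $\mathbf S:\mathbf{CPG}\to\mathbf{RSS}$, acting identically on morphisms, are functors, and they are mutually inverse: $\mathbf S\circ\mathbf G=\mathrm{id}_{\mathbf{RSS}}$ and $\mathbf G\circ\mathbf S=\mathrm{id}_{\mathbf{CPG}}$. In particular the categories $\mathbf{RSS}$ and $\mathbf{CPG}$ are isomorphic. -/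

import Mathlib

open CategoryTheory

universe u

namespace RegStar

/-! ### Projection algebras

The unary operations of a projection algebra `P` are encoded by `th : P → P → P`, where `th p` is
the operation `θ_p`.  Maps are usually written on the right in this context, so `q θ_p` is
`th p q`, and `q θ_p θ_r` is `th r (th p q)`. -/

section ProjectionAlgebra

variable {P : Type u}

/-- The axioms of a projection algebra. -/
structure IsProjectionAlgebra (th : P → P → P) : Prop where
  /-- `p θ_p = p` -/
  p1 : ∀ p, th p p = p
  /-- `θ_p θ_p = θ_p` -/
  p2 : ∀ p x, th p (th p x) = th p x
  /-- `p θ_q θ_p = q θ_p` -/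
  p3 : ∀ p q, th p (th q p) = th p q
  /-- `θ_p θ_q θ_p = θ_{q θ_p}` -/
  p4 : ∀ p q x, th p (th q (th p x)) = th (th p q) x
  /-- `θ_p θ_q θ_p θ_q = θ_p θ_q` -/
  p5 : ∀ p q x, th q (th p (th q (th p x))) = th q (th p x)

/-- The partial order of a projection algebra: `p ≤ q` iff `p = p θ_q`. -/
def PLe (th : P → P → P) (p q : P) : Prop := p = th q p

/-- The relation `p ≤_F q` iff `p = q θ_p`. -/
def LeF (th : P → P → P) (p q : P) : Prop := p = th p q

/-- The relation `F`, the intersection of `≤_F` with its converse. -/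
def FRel (th : P → P → P) (p q : P) : Prop := LeF th p q ∧ LeF th q p

theorem FRel.symm {th : P → P → P} {p q : P} (h : FRel th p q) : FRel th q p := ⟨h.2, h.1⟩

namespace IsProjectionAlgebra

variable {th : P → P → P}

theorem ple_th (h : IsProjectionAlgebra th) (p q : P) : PLe th (th p q) p := (h.p2 p q).symm

theorem leF_th (h : IsProjectionAlgebra th) (p q : P) : LeF th (th p q) (th q p) := by
  change th p q = th (th p q) (th q p)
  rw [← h.p4, h.p3 p q, h.p3 q p, h.p3 p q]

/-- For all `p` and `q`, the projections `q θ_p` and `p θ_q` are `F`-related. -/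
theorem fRel_th (h : IsProjectionAlgebra th) (p q : P) : FRel th (th p q) (th q p) :=
  ⟨h.leF_th p q, h.leF_th q p⟩

theorem leF_of_leF_of_ple (h : IsProjectionAlgebra th) {p q r : P} (hpq : LeF th p q)
    (hqr : PLe th q r) : LeF th p r := by
  have hp : ∀ x, th p (th q (th p x)) = th p x := fun x => by
    rw [h.p4]; exact congrArg (fun t => th t x) hpq.symm
  have hq : ∀ x, th r (th q (th r x)) = th q x := fun x => by
    rw [h.p4]; exact congrArg (fun t => th t x) hqr.symm
  change p = th p r
  have h1 : th p (th q (th p r)) = th p r := hp r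
  rw [← hq, h.p3 r p, hq, h.p3 p q] at h1
  exact hpq.trans h1

theorem fRel_th_of_leF (h : IsProjectionAlgebra th) {p r : P} (hpr : LeF th p r) :
    FRel th p (th r p) := by
  constructor
  · change p = th p (th r p)
    rw [h.p3]; exact hpr
  · change th r p = th (th r p) p
    rw [← h.p4, h.p3 p r, h.p3 r p]

end IsProjectionAlgebra

end ProjectionAlgebra

/-! ### Paths and chains -/

section Chains

variable {P : Type u}

/-- A `P`-path `(p₁, …, p_k)`, `k ≥ 1`, with `p₁ F p₂ F ⋯ F p_k`.  Here `head` is `p₁` and `tail` is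
the list `[p₂, …, p_k]`. -/
structure Path (th : P → P → P) where
  head : P
  tail : List P
  isChain : List.IsChain (FRel th) (head :: tail)

namespace Path

variable {th : P → P → P}

/-- The last entry `p_k` of a path. -/
def last (p : Path th) : P := p.tail.getLastD p.head

/-- The path `(p)` of length one, identified with the object `p`. -/
def single (th : P → P → P) (p : P) : Path th := ⟨p, [], List.isChain_singleton p⟩

/-- The path `(p, q)`, for `p F q`. -/
def pair (p q : P) (h : FRel th p q) : Path th :=
  ⟨p, [q], List.isChain_cons_cons.2 ⟨h, List.isChain_singleton q⟩⟩

/-- The path `(p, q, p)`, for `p F q`. -/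
def triple (p q : P) (h : FRel th p q) : Path th :=
  ⟨p, [q, p], List.isChain_cons_cons.2 ⟨h, List.isChain_cons_cons.2
    ⟨h.symm, List.isChain_singleton p⟩⟩⟩

theorem isChain_append_of_last {R : P → P → Prop} : ∀ (l : List P) (p : P) (m : List P),
    List.IsChain R (p :: l) → List.IsChain R (l.getLastD p :: m) → List.IsChain R (p :: (l ++ m))
  | [], _, _, _, h => h
  | q :: l, p, m, h, h' => by
    rw [List.isChain_cons_cons] at h
    rw [List.getLastD_cons] at h'
    exact List.isChain_cons_cons.2 ⟨h.1, isChain_append_of_last l q m h.2 h'⟩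

/-- Composition of paths:
`(p₁, …, p_k) ∘ (q₁, …, q_l) = (p₁, …, p_k = q₁, q₂, …, q_l)`, defined when `p_k = q₁`. -/
def comp (p q : Path th) (h : p.last = q.head) : Path th where
  head := p.head
  tail := p.tail ++ q.tail
  isChain := isChain_append_of_last p.tail p.head q.tail p.isChain
    ((congrArg (fun x => List.IsChain (FRel th) (x :: q.tail)) h).mpr q.isChain)

theorem last_comp (p q : Path th) (h : p.last = q.head) : (p.comp q h).last = q.last := by
  obtain ⟨p₁, l, hp⟩ := p
  change (l ++ q.tail).getLastD p₁ = q.tail.getLastD q.head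
  rw [← h]
  change _ = q.tail.getLastD (l.getLastD p₁)
  clear h
  induction l generalizing p₁ with
  | nil => rfl
  | cons a l ih =>
    rw [List.cons_append, List.getLastD_cons, List.getLastD_cons]
    exact ih a (List.isChain_cons_cons.1 hp).2

/-- The tail of a restricted path: `restrictTail th q [p₂, …, p_k] = [q₂, …, q_k]`, where
`q₁ = q` and `q_i = q_{i-1} θ_{p_i}`. -/
def restrictTail (th : P → P → P) : P → List P → List P
  | _, [] => []
  | q, p :: l => th p q :: restrictTail th (th p q) l

theorem isChain_restrictTail (hA : IsProjectionAlgebra th) : ∀ (l : List P) (p q : P),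
    PLe th q p → List.IsChain (FRel th) (p :: l) →
      List.IsChain (FRel th) (q :: restrictTail th q l)
  | [], _, q, _, _ => List.isChain_singleton q
  | s :: l, p, q, hqp, hl => by
    rw [List.isChain_cons_cons] at hl
    refine List.isChain_cons_cons.2 ⟨?_,
      isChain_restrictTail hA l s (th s q) (hA.ple_th s q) hl.2⟩
    refine hA.fRel_th_of_leF ?_
    have h1 : ∀ x, th p (th q (th p x)) = th q x := fun x => by
      rw [hA.p4]; exact congrArg (fun t => th t x) hqp.symm
    change q = th q s
    have hps : p = th p s := hl.1.1
    have h2 : th q s = th p (th q p) := by rw [← h1 s, ← hps]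
    rw [h2, hA.p3]
    exact hqp

/-- The left restriction of a path `(p₁, …, p_k)` to `q ≤ p₁`: this is `(q₁, …, q_k)`, where
`q₁ = q` and `q_i = q_{i-1} θ_{p_i}`. -/
def restrict (hA : IsProjectionAlgebra th) (p : Path th) (q : P) (hq : PLe th q p.head) :
    Path th where
  head := q
  tail := restrictTail th q p.tail
  isChain := isChain_restrictTail hA p.tail p.head q hq p.isChain

/-- The order on paths: `p ≤ q` iff `p` is a left restriction of `q`. -/
def Le (hA : IsProjectionAlgebra th) (p q : Path th) : Prop :=
  ∃ (r : P) (hr : PLe th r q.head), p = q.restrict hA r hr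

/-- The congruence on the path category generated by the pairs `((p, p), (p))` and
`((p, q, p), (p))`, the latter for `p F q`.  (The hypothesis `p F p` in `om₁` always holds in a
projection algebra.) -/
inductive Approx (th : P → P → P) : Path th → Path th → Prop
  | om₁ (p : P) (h : FRel th p p) : Approx th (pair p p h) (single th p)
  | om₂ (p q : P) (h : FRel th p q) : Approx th (triple p q h) (single th p)
  | refl (p : Path th) : Approx th p p
  | symm {p q : Path th} : Approx th p q → Approx th q p
  | trans {p q r : Path th} : Approx th p q → Approx th q r → Approx th p r
  | comp_left (u : Path th) {p q : Path th} (hp : u.last = p.head) (hq : u.last = q.head) :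
      Approx th p q → Approx th (u.comp p hp) (u.comp q hq)
  | comp_right (v : Path th) {p q : Path th} (hp : p.last = v.head) (hq : q.last = v.head) :
      Approx th p q → Approx th (p.comp v hp) (q.comp v hq)

theorem Approx.head_eq {p q : Path th} (h : Approx th p q) : p.head = q.head := by
  induction h with
  | om₁ => rfl
  | om₂ => rfl
  | refl => rfl
  | symm _ ih => exact ih.symm
  | trans _ _ ih₁ ih₂ => exact ih₁.trans ih₂
  | comp_left => rfl
  | comp_right _ _ _ _ ih => exact ih

theorem Approx.last_eq {p q : Path th} (h : Approx th p q) : p.last = q.last := by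
  induction h with
  | om₁ => rfl
  | om₂ => rfl
  | refl => rfl
  | symm _ ih => exact ih.symm
  | trans _ _ ih₁ ih₂ => exact ih₁.trans ih₂
  | comp_left u hp hq _ ih => rw [last_comp, last_comp, ih]
  | comp_right v hp hq _ ih => rw [last_comp, last_comp]

/-- The congruence `≈` as a setoid. -/
def setoid (th : P → P → P) : Setoid (Path th) where
  r := Approx th
  iseqv := ⟨Approx.refl, Approx.symm, Approx.trans⟩

end Path

/-- The (morphism set of the) chain groupoid of a projection algebra: the quotient of the path
category by the congruence `≈`. -/
def Chain (th : P → P → P) : Type u := Quotient (Path.setoid th)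

namespace Chain

variable {th : P → P → P}

/-- The chain `[p₁, …, p_k]` of a path. -/
def mk (p : Path th) : Chain th := Quotient.mk (Path.setoid th) p

theorem mk_eq_mk {p q : Path th} : mk p = mk q ↔ Path.Approx th p q :=
  ⟨fun h => Quotient.exact h, fun h => Quotient.sound h⟩

/-- The domain `p₁` of a chain `[p₁, …, p_k]`. -/
def dom (c : Chain th) : P := Quotient.lift Path.head (fun _ _ h => Path.Approx.head_eq h) c

/-- The range `p_k` of a chain `[p₁, …, p_k]`. -/
def cod (c : Chain th) : P := Quotient.lift Path.last (fun _ _ h => Path.Approx.last_eq h) c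

/-- The chain `[p]` of length one, identified with the object `p`. -/
def single (th : P → P → P) (p : P) : Chain th := mk (Path.single th p)

/-- The chain `[p, q]`, for `p F q`. -/
def pair (p q : P) (h : FRel th p q) : Chain th := mk (Path.pair p q h)

theorem mk_out (c : Chain th) : mk (Quotient.out c) = c := Quotient.out_eq c

theorem last_out (c : Chain th) : (Quotient.out c).last = c.cod := congrArg cod (mk_out c)

theorem head_out (c : Chain th) : (Quotient.out c).head = c.dom := congrArg dom (mk_out c)

/-- Composition of chains, `[p] ∘ [q] = [p ∘ q]` (see `mk_comp_mk`). -/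
noncomputable def comp (c d : Chain th) (h : c.cod = d.dom) : Chain th :=
  mk ((Quotient.out c).comp (Quotient.out d) ((last_out c).trans (h.trans (head_out d).symm)))

theorem mk_comp_mk (p q : Path th) (h : p.last = q.head) :
    comp (mk p) (mk q) h = mk (p.comp q h) := by
  have hp := mk_eq_mk.1 (mk_out (mk p))
  have hq := mk_eq_mk.1 (mk_out (mk q))
  refine mk_eq_mk.2 (Path.Approx.trans (Path.Approx.comp_right _ _ ?_ hp)
    (Path.Approx.comp_left _ _ _ hq))
  exact h.trans (head_out (mk q)).symm

/-- The order on chains: `c ≤ d` iff `p ≤ q` for some paths `p ∈ c` and `q ∈ d`. -/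
def Le (hA : IsProjectionAlgebra th) (c d : Chain th) : Prop :=
  ∃ p q : Path th, mk p = c ∧ mk q = d ∧ p.Le hA q

end Chain

/-! ### The action of a projection algebra morphism on chains -/

section Map

variable {P' : Type u} {th : P → P → P} {th' : P' → P' → P'}

/-- A projection algebra morphism: `(p θ_q) φ = (p φ) θ'_{q φ}`. -/
def IsProjectionAlgebraHom (th : P → P → P) (th' : P' → P' → P') (φ : P → P') : Prop :=
  ∀ p q, φ (th q p) = th' (φ q) (φ p)

theorem FRel.map {φ : P → P'} (hφ : IsProjectionAlgebraHom th th' φ) {p q : P}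
    (h : FRel th p q) : FRel th' (φ p) (φ q) := by
  constructor
  · exact (congrArg φ h.1).trans (hφ q p)
  · exact (congrArg φ h.2).trans (hφ p q)

/-- `(p₁, …, p_k) ↦ (p₁ φ, …, p_k φ)` -/
def Path.map (φ : P → P') (hφ : IsProjectionAlgebraHom th th' φ) (p : Path th) : Path th' where
  head := φ p.head
  tail := p.tail.map φ
  isChain := List.isChain_map_of_isChain φ (fun _ _ h => FRel.map hφ h) p.isChain

theorem Path.last_map (φ : P → P') (hφ : IsProjectionAlgebraHom th th' φ) (p : Path th) :
    (p.map φ hφ).last = φ p.last := by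
  obtain ⟨p₁, l, hp⟩ := p
  simp only [Path.map, Path.last]
  clear hp
  induction l generalizing p₁ with
  | nil => rfl
  | cons a l ih => rw [List.map_cons, List.getLastD_cons, List.getLastD_cons]; exact ih a

theorem Path.map_comp (φ : P → P') (hφ : IsProjectionAlgebraHom th th' φ) (p q : Path th)
    (h : p.last = q.head) : (p.comp q h).map φ hφ =
      (p.map φ hφ).comp (q.map φ hφ) ((last_map φ hφ p).trans (congrArg φ h)) := by
  simp [Path.map, Path.comp]

theorem Path.Approx.map (φ : P → P') (hφ : IsProjectionAlgebraHom th th' φ) {p q : Path th}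
    (h : Path.Approx th p q) : Path.Approx th' (p.map φ hφ) (q.map φ hφ) := by
  induction h with
  | om₁ p h => exact .om₁ (φ p) (FRel.map hφ h)
  | om₂ p q h => exact .om₂ (φ p) (φ q) (FRel.map hφ h)
  | refl p => exact .refl _
  | symm _ ih => exact ih.symm
  | trans _ _ ih₁ ih₂ => exact ih₁.trans ih₂
  | comp_left u hp hq _ ih => rw [Path.map_comp, Path.map_comp]; exact .comp_left _ _ _ ih
  | comp_right v hp hq _ ih => rw [Path.map_comp, Path.map_comp]; exact .comp_right _ _ _ ih

/-- The map `[p₁, …, p_k] ↦ [p₁ φ, …, p_k φ]` on chains induced by a projection algebra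
morphism. -/
def Chain.map (φ : P → P') (hφ : IsProjectionAlgebraHom th th' φ) : Chain th → Chain th' :=
  Quotient.lift (fun p => Chain.mk (p.map φ hφ)) (fun _ _ h => Chain.mk_eq_mk.2 (h.map φ hφ))

end Map

end Chains

/-! ### Ordered groupoids

A small category is identified with its set `G` of morphisms, and its objects are identified with
the identity morphisms. -/

/-- The data of a small category with an involution and an order: the set `obj` of objects
(identities), domains and ranges, the composition `a ∘ b` (left to right), defined when
`cod a = dom b`, the involution, and the order. -/
structure OrderedGroupoidData (G : Type u) where
  obj : Set G
  dom : G → G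
  cod : G → G
  comp : (a b : G) → cod a = dom b → G
  inv : G → G
  le : G → G → Prop

/-- The axioms of a small category, in the one-sorted form. -/
structure OrderedGroupoidData.IsCategory {G : Type u} (D : OrderedGroupoidData G) : Prop where
  dom_mem : ∀ a, D.dom a ∈ D.obj
  cod_mem : ∀ a, D.cod a ∈ D.obj
  dom_obj : ∀ p ∈ D.obj, D.dom p = p
  cod_obj : ∀ p ∈ D.obj, D.cod p = p
  dom_comp : ∀ a b h, D.dom (D.comp a b h) = D.dom a
  cod_comp : ∀ a b h, D.cod (D.comp a b h) = D.cod b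
  id_comp : ∀ a, D.comp (D.dom a) a (cod_obj _ (dom_mem a)) = a
  comp_id : ∀ a, D.comp a (D.cod a) (dom_obj _ (cod_mem a)).symm = a
  assoc : ∀ a b c (hab : D.cod a = D.dom b) (hbc : D.cod b = D.dom c),
    D.comp (D.comp a b hab) c ((cod_comp a b hab).trans hbc) =
      D.comp a (D.comp b c hbc) (hab.trans (dom_comp b c hbc).symm)

/-- The axioms of a groupoid. -/
structure OrderedGroupoidData.IsGroupoid {G : Type u} (D : OrderedGroupoidData G) : Prop
    extends D.IsCategory where
  dom_inv : ∀ a, D.dom (D.inv a) = D.cod a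
  cod_inv : ∀ a, D.cod (D.inv a) = D.dom a
  inv_inv : ∀ a, D.inv (D.inv a) = a
  inv_comp : ∀ a b (h : D.cod a = D.dom b), D.inv (D.comp a b h) =
    D.comp (D.inv b) (D.inv a) ((cod_inv b).trans (h.symm.trans (dom_inv a).symm))
  comp_inv : ∀ a, D.comp a (D.inv a) (dom_inv a).symm = D.dom a

/-- The axioms of an ordered groupoid. -/
structure OrderedGroupoidData.IsOrderedGroupoid {G : Type u} (D : OrderedGroupoidData G) : Prop
    extends D.IsGroupoid where
  le_refl : ∀ a, D.le a a
  le_antisymm : ∀ a b, D.le a b → D.le b a → a = b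
  le_trans : ∀ a b c, D.le a b → D.le b c → D.le a c
  dom_le : ∀ a b, D.le a b → D.le (D.dom a) (D.dom b)
  cod_le : ∀ a b, D.le a b → D.le (D.cod a) (D.cod b)
  inv_le : ∀ a b, D.le a b → D.le (D.inv a) (D.inv b)
  comp_le : ∀ a b c d (hac : D.cod a = D.dom c) (hbd : D.cod b = D.dom d),
    D.le a b → D.le c d → D.le (D.comp a c hac) (D.comp b d hbd)
  existsUnique_restriction : ∀ a, ∀ p ∈ D.obj, D.le p (D.dom a) →
    ∃! u, D.le u a ∧ D.dom u = p

namespace OrderedGroupoidData.IsOrderedGroupoid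

variable {G : Type u} {D : OrderedGroupoidData G} (h : D.IsOrderedGroupoid)

/-- The left restriction of `a` to an object `p ≤ dom a`: the unique `u ≤ a` with `dom u = p`. -/
noncomputable def lres (a : G) (p : D.obj) (hp : D.le p (D.dom a)) : G :=
  (h.existsUnique_restriction a p p.2 hp).choose

theorem dom_lres (a : G) (p : D.obj) (hp : D.le p (D.dom a)) : D.dom (h.lres a p hp) = p :=
  (h.existsUnique_restriction a p p.2 hp).choose_spec.1.2

theorem lres_le (a : G) (p : D.obj) (hp : D.le p (D.dom a)) : D.le (h.lres a p hp) a :=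
  (h.existsUnique_restriction a p p.2 hp).choose_spec.1.1

theorem le_dom_inv (h : D.IsOrderedGroupoid) {a : G} {q : D.obj} (hq : D.le q (D.cod a)) : D.le q (D.dom (D.inv a)) := by
  rw [h.dom_inv]; exact hq

/-- The right restriction of `a` to an object `q ≤ cod a`, which is the inverse of the left
restriction of `a⁻¹` to `q`; it is the unique `v ≤ a` with `cod v = q`. -/
noncomputable def rres (a : G) (q : D.obj) (hq : D.le q (D.cod a)) : G :=
  D.inv (h.lres (D.inv a) q (h.le_dom_inv hq))

theorem cod_rres (a : G) (q : D.obj) (hq : D.le q (D.cod a)) : D.cod (h.rres a q hq) = q := by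
  rw [rres, h.cod_inv, h.dom_lres]

/-- The domain of a morphism, as an object. -/
abbrev domO (a : G) : D.obj := ⟨D.dom a, h.dom_mem a⟩

/-- The range of a morphism, as an object. -/
abbrev codO (a : G) : D.obj := ⟨D.cod a, h.cod_mem a⟩

theorem domO_inv (a : G) : h.domO (D.inv a) = h.codO a := Subtype.ext (h.dom_inv a)

/-- The map `ϑ_a`, sending an object `p ≤ dom a` to the range of the left restriction of `a` to
`p`. -/
noncomputable def vt (a : G) (p : D.obj) (hp : D.le p (D.dom a)) : D.obj :=
  h.codO (h.lres a p hp)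

theorem vt_le (a : G) (p : D.obj) (hp : D.le p (D.dom a)) : D.le (h.vt a p hp) (D.cod a) :=
  h.cod_le _ _ (h.lres_le a p hp)

end OrderedGroupoidData.IsOrderedGroupoid

/-! ### Projection groupoids -/

/-- The data of a (weak) projection groupoid `(P, G)`: a groupoid `G` as above and the unary
operations on its object set `P`. -/
structure ProjectionGroupoidData (G : Type u) extends OrderedGroupoidData G where
  th : obj → obj → obj

/-- A weak projection groupoid: an ordered groupoid whose object set is a projection algebra, such
that the order of the groupoid restricts to the order of the projection algebra. -/
structure ProjectionGroupoidData.IsWeakProjectionGroupoid {G : Type u}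
    (D : ProjectionGroupoidData G) : Prop extends D.IsOrderedGroupoid where
  isProjectionAlgebra : IsProjectionAlgebra D.th
  le_iff_ple : ∀ p q : D.obj, D.le p q ↔ PLe D.th p q

namespace ProjectionGroupoidData.IsWeakProjectionGroupoid

variable {G : Type u} {D : ProjectionGroupoidData G} (h : D.IsWeakProjectionGroupoid)

theorem th_le (h : D.IsWeakProjectionGroupoid) (p q : D.obj) : D.le (D.th p q) p :=
  (h.le_iff_ple _ _).2 (h.isProjectionAlgebra.ple_th p q)

/-- The map `Θ_a = θ_{dom a} ϑ_a`. -/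
noncomputable def Th (a : G) (p : D.obj) : D.obj :=
  h.vt a (D.th (h.domO a) p) (h.th_le (h.domO a) p)

/-- `Θ_{a⁻¹} = θ_{cod a} ϑ_{a⁻¹}` -/
theorem Th_inv (a : G) (p : D.obj) : h.Th (D.inv a) p =
    h.vt (D.inv a) (D.th (h.codO a) p) (h.le_dom_inv (h.th_le (h.codO a) p)) := by
  have key : ∀ (q : D.obj) (hq : h.domO (D.inv a) = q)
      (hle : D.le (D.th q p) (D.dom (D.inv a))),
      h.Th (D.inv a) p = h.vt (D.inv a) (D.th q p) hle := by
    rintro q rfl hle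
    rfl
  exact key _ (h.domO_inv a) _

theorem Th_le (a : G) (p : D.obj) : D.le (h.Th a p) (D.cod a) := h.vt_le a _ _

end ProjectionGroupoidData.IsWeakProjectionGroupoid

/-- A projection groupoid: a weak projection groupoid satisfying the identity
`θ_{p Θ_a} = Θ_{a⁻¹} θ_p Θ_a` for all morphisms `a` and all projections `p`. -/
structure ProjectionGroupoidData.IsProjectionGroupoid {G : Type u}
    (D : ProjectionGroupoidData G) : Prop extends D.IsWeakProjectionGroupoid where
  th_Th : ∀ (a : G) (p x : D.obj), D.th (toIsWeakProjectionGroupoid.Th a p) x =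
    toIsWeakProjectionGroupoid.Th a (D.th p (toIsWeakProjectionGroupoid.Th (D.inv a) x))

namespace ProjectionGroupoidData.IsProjectionGroupoid

variable {G : Type u} {D : ProjectionGroupoidData G} (h : D.IsProjectionGroupoid)

/-- The pair `(e, f)` is `b`-linked: `f = e Θ_b θ_f` and `e = f Θ_{b⁻¹} θ_e`. -/
def Linked (b : G) (e f : D.obj) : Prop :=
  f = D.th f (h.Th b e) ∧ e = D.th e (h.Th (D.inv b) f)

theorem Linked.symm {b : G} {e f : D.obj} (hl : h.Linked b e f) : h.Linked (D.inv b) f e := by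
  refine ⟨hl.2, ?_⟩
  rw [h.inv_inv]
  exact hl.1

/-- If `(e, f)` is `b`-linked, then `e F e₁` where `e₁ = e θ_{dom b}`. -/
theorem Linked.fRel₁ {b : G} {e f : D.obj} (hl : h.Linked b e f) :
    FRel D.th e (D.th (h.domO b) e) := by
  refine h.isProjectionAlgebra.fRel_th_of_leF
    (h.isProjectionAlgebra.leF_of_leF_of_ple hl.2 ((h.le_iff_ple _ _).1 ?_))
  have h1 := h.Th_le (D.inv b) f
  rw [h.cod_inv] at h1
  exact h1

/-- If `(e, f)` is `b`-linked, then `e F e₂` where `e₂ = f Θ_{b⁻¹}`. -/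
theorem Linked.fRel₂ {b : G} {e f : D.obj} (hl : h.Linked b e f) :
    FRel D.th e (h.Th (D.inv b) f) := by
  refine ⟨hl.2, ?_⟩
  change _ = D.th _ _
  rw [h.th_Th, h.inv_inv, ← hl.1]

/-- If `(e, f)` is `b`-linked, then `f₁ F f` where `f₁ = e Θ_b`. -/
theorem Linked.fRel₃ {b : G} {e f : D.obj} (hl : h.Linked b e f) :
    FRel D.th (h.Th b e) f := by
  have h1 := (Linked.fRel₂ h (Linked.symm h hl)).symm
  rw [h.inv_inv] at h1
  exact h1

/-- If `(e, f)` is `b`-linked, then `f₂ F f` where `f₂ = f θ_{cod b}`. -/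
theorem Linked.fRel₄ {b : G} {e f : D.obj} (hl : h.Linked b e f) :
    FRel D.th (D.th (h.codO b) f) f := by
  have h1 := (Linked.fRel₁ h (Linked.symm h hl)).symm
  rw [h.domO_inv] at h1
  exact h1

end ProjectionGroupoidData.IsProjectionGroupoid

/-! ### Chained projection groupoids -/

/-- The data of a (weak) chained projection groupoid `(P, G, ε)`: here `eval` is the map `ε` from
the chain groupoid of `P` to `G`. -/
structure ChainedProjectionGroupoidData (G : Type u) extends ProjectionGroupoidData G where
  eval : Chain th → G

/-- A weak chained projection groupoid: a projection groupoid together with an evaluation map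
`ε`, i.e. an order-preserving functor from the chain groupoid which fixes each object. -/
structure ChainedProjectionGroupoidData.IsWeakChainedProjectionGroupoid {G : Type u}
    (D : ChainedProjectionGroupoidData G) : Prop extends D.IsProjectionGroupoid where
  dom_eval : ∀ c : Chain D.th, D.dom (D.eval c) = c.dom
  cod_eval : ∀ c : Chain D.th, D.cod (D.eval c) = c.cod
  eval_single : ∀ p : D.obj, D.eval (Chain.single D.th p) = p
  eval_comp : ∀ (c d : Chain D.th) (hcd : c.cod = d.dom), D.eval (c.comp d hcd) =
    D.comp (D.eval c) (D.eval d)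
      ((cod_eval c).trans ((congrArg Subtype.val hcd).trans (dom_eval d).symm))
  eval_le : ∀ c d : Chain D.th, c.Le isProjectionAlgebra d → D.le (D.eval c) (D.eval d)

namespace ChainedProjectionGroupoidData.IsWeakChainedProjectionGroupoid

variable {G : Type u} {D : ChainedProjectionGroupoidData G}
  (h : D.IsWeakChainedProjectionGroupoid)

/-- The morphism `ε[p, q]`, for `p F q`. -/
def evalPair (_ : D.IsWeakChainedProjectionGroupoid) (p q : D.obj) (hpq : FRel D.th p q) : G :=
  D.eval (Chain.pair p q hpq)

theorem dom_evalPair (p q : D.obj) (hpq : FRel D.th p q) : D.dom (h.evalPair p q hpq) = p :=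
  h.dom_eval _

theorem cod_evalPair (p q : D.obj) (hpq : FRel D.th p q) : D.cod (h.evalPair p q hpq) = q :=
  h.cod_eval _

/-- The composite `a ∘ b ∘ c` of three morphisms. -/
def comp₃ (h : D.IsWeakChainedProjectionGroupoid) (a b c : G) (hab : D.cod a = D.dom b)
    (hbc : D.cod b = D.dom c) : G :=
  D.comp (D.comp a b hab) c ((h.cod_comp a b hab).trans hbc)

/-- `λ(e, b, f) = ε[e, e₁] ∘ b' ∘ ε[f₁, f]` for a `b`-linked pair `(e, f)`, where
`e₁ = e θ_{dom b}`, `f₁ = e Θ_b`, and `b'` is the left restriction of `b` to `e₁`. -/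
noncomputable def lam (b : G) (e f : D.obj) (hl : h.Linked b e f) : G :=
  h.comp₃ (h.evalPair e (D.th (h.domO b) e) (hl.fRel₁))
    (h.lres b (D.th (h.domO b) e) (h.th_le (h.domO b) e))
    (h.evalPair (h.Th b e) f hl.fRel₃)
    ((h.cod_evalPair _ _ _).trans (h.dom_lres _ _ _).symm)
    (h.dom_evalPair (h.Th b e) f hl.fRel₃).symm

/-- `ρ(e, b, f) = ε[e, e₂] ∘ b' ∘ ε[f₂, f]` for a `b`-linked pair `(e, f)`, where
`e₂ = f Θ_{b⁻¹}`, `f₂ = f θ_{cod b}`, and `b'` is the right restriction of `b` to `f₂` (which is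
also the left restriction of `b` to `e₂`). -/
noncomputable def rho (b : G) (e f : D.obj) (hl : h.Linked b e f) : G :=
  h.comp₃ (h.evalPair e (h.Th (D.inv b) f) hl.fRel₂)
    (h.rres b (D.th (h.codO b) f) (h.th_le (h.codO b) f))
    (h.evalPair (D.th (h.codO b) f) f hl.fRel₄)
    ((h.cod_evalPair _ _ _).trans ((congrArg Subtype.val (h.Th_inv b f)).trans
      (h.dom_inv _).symm))
    ((h.cod_rres _ _ _).trans (h.dom_evalPair _ _ _).symm)

/-- The product of arbitrary morphisms `a` and `b`: if `p = cod a`, `q = dom b`, `p' = q θ_p` and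
`q' = p θ_q`, then it is `a' ∘ ε[p', q'] ∘ b'`, where `a'` is the right restriction of `a` to `p'`
and `b'` is the left restriction of `b` to `q'`. -/
noncomputable def pr (a b : G) : G :=
  h.comp₃ (h.rres a (D.th (h.codO a) (h.domO b)) (h.th_le (h.codO a) (h.domO b)))
    (h.evalPair (D.th (h.codO a) (h.domO b)) (D.th (h.domO b) (h.codO a))
      (h.isProjectionAlgebra.fRel_th (h.codO a) (h.domO b)))
    (h.lres b (D.th (h.domO b) (h.codO a)) (h.th_le (h.domO b) (h.codO a)))
    ((h.cod_rres _ _ _).trans (h.dom_evalPair _ _ _).symm)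
    ((h.cod_evalPair _ _ _).trans (h.dom_lres _ _ _).symm)

end ChainedProjectionGroupoidData.IsWeakChainedProjectionGroupoid

/-- A chained projection groupoid: a weak chained projection groupoid satisfying the coherence
condition `λ(e, b, f) = ρ(e, b, f)` for every morphism `b` and every `b`-linked pair `(e, f)`. -/
structure ChainedProjectionGroupoidData.IsChainedProjectionGroupoid {G : Type u}
    (D : ChainedProjectionGroupoidData G) : Prop extends D.IsWeakChainedProjectionGroupoid where
  coherent : ∀ (b : G) (e f : D.obj) (hl : toIsProjectionGroupoid.Linked b e f),
    toIsWeakChainedProjectionGroupoid.lam b e f hl =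
      toIsWeakChainedProjectionGroupoid.rho b e f hl

/-- A bundled chained projection groupoid. -/
structure ChainedProjectionGroupoid : Type (u + 1) where
  carrier : Type u
  data : ChainedProjectionGroupoidData carrier
  isChainedProjectionGroupoid : data.IsChainedProjectionGroupoid

/-- A map is a chained projection functor if it is an order-preserving functor, its restriction to
objects is a projection algebra morphism, and it respects the evaluation maps. -/
structure IsChainedProjectionFunctor {G G' : Type u} (D : ChainedProjectionGroupoidData G)
    (D' : ChainedProjectionGroupoidData G') (φ : G → G') : Prop where
  map_obj : ∀ p ∈ D.obj, φ p ∈ D'.obj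
  map_dom : ∀ a, φ (D.dom a) = D'.dom (φ a)
  map_cod : ∀ a, φ (D.cod a) = D'.cod (φ a)
  map_comp : ∀ (a b : G) (hab : D.cod a = D.dom b), φ (D.comp a b hab) =
    D'.comp (φ a) (φ b) ((map_cod a).symm.trans ((congrArg φ hab).trans (map_dom b)))
  map_le : ∀ a b, D.le a b → D'.le (φ a) (φ b)
  map_th : IsProjectionAlgebraHom D.th D'.th (fun p : D.obj => (⟨φ p, map_obj p p.2⟩ : D'.obj))
  map_eval : ∀ c : Chain D.th,
    φ (D.eval c) = D'.eval (c.map (fun p : D.obj => (⟨φ p, map_obj p p.2⟩ : D'.obj)) map_th)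

theorem Chain.map_id {P : Type u} {th : P → P → P}
    (hφ : IsProjectionAlgebraHom th th (fun p => p)) (c : Chain th) :
    c.map (fun p => p) hφ = c := by
  induction c using Quotient.inductionOn with
  | h p =>
    refine congrArg Chain.mk ?_
    obtain ⟨p₁, l, hp⟩ := p
    simp [Path.map]

theorem Chain.map_map {P P' P'' : Type u} {th : P → P → P} {th' : P' → P' → P'}
    {th'' : P'' → P'' → P''} {φ : P → P'} {ψ : P' → P''} (hφ : IsProjectionAlgebraHom th th' φ)
    (hψ : IsProjectionAlgebraHom th' th'' ψ)
    (hφψ : IsProjectionAlgebraHom th th'' (fun p => ψ (φ p))) (c : Chain th) :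
    (c.map φ hφ).map ψ hψ = c.map (fun p => ψ (φ p)) hφψ := by
  induction c using Quotient.inductionOn with
  | h p =>
    refine congrArg Chain.mk ?_
    obtain ⟨p₁, l, hp⟩ := p
    simp [Path.map, Function.comp_def]

theorem IsChainedProjectionFunctor.id {G : Type u} (D : ChainedProjectionGroupoidData G) :
    IsChainedProjectionFunctor D D (fun a => a) where
  map_obj _ h := h
  map_dom _ := rfl
  map_cod _ := rfl
  map_comp _ _ _ := rfl
  map_le _ _ h := h
  map_th _ _ := rfl
  map_eval c := congrArg D.eval (Chain.map_id _ c).symm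

theorem IsChainedProjectionFunctor.comp {G G' G'' : Type u} {D : ChainedProjectionGroupoidData G}
    {D' : ChainedProjectionGroupoidData G'} {D'' : ChainedProjectionGroupoidData G''}
    {φ : G → G'} {ψ : G' → G''} (hψ : IsChainedProjectionFunctor D' D'' ψ)
    (hφ : IsChainedProjectionFunctor D D' φ) :
    IsChainedProjectionFunctor D D'' (fun a => ψ (φ a)) where
  map_obj p hp := hψ.map_obj _ (hφ.map_obj p hp)
  map_dom a := (congrArg ψ (hφ.map_dom a)).trans (hψ.map_dom _)
  map_cod a := (congrArg ψ (hφ.map_cod a)).trans (hψ.map_cod _)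
  map_comp a b hab := (congrArg ψ (hφ.map_comp a b hab)).trans (hψ.map_comp _ _ _)
  map_le a b h := hψ.map_le _ _ (hφ.map_le a b h)
  map_th p q := (congrArg (fun x : D'.obj => (⟨ψ x, hψ.map_obj x x.2⟩ : D''.obj))
    (hφ.map_th p q)).trans (hψ.map_th _ _)
  map_eval c := (congrArg ψ (hφ.map_eval c)).trans ((hψ.map_eval _).trans
    (congrArg D''.eval (Chain.map_map hφ.map_th hψ.map_th _ c)))

namespace ChainedProjectionGroupoid

/-- A chained projection functor between chained projection groupoids. -/
@[ext]
structure Hom (X Y : ChainedProjectionGroupoid.{u}) : Type u where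
  toFun : X.carrier → Y.carrier
  isChainedProjectionFunctor : IsChainedProjectionFunctor X.data Y.data toFun

/-- The category of chained projection groupoids and chained projection functors. -/
instance : Category ChainedProjectionGroupoid.{u} where
  Hom := Hom
  id X := ⟨fun a => a, .id X.data⟩
  comp f g := ⟨fun a => g.toFun (f.toFun a),
    .comp g.isChainedProjectionFunctor f.isChainedProjectionFunctor⟩

end ChainedProjectionGroupoid

/-! ### Regular `*`-semigroups -/

/-- A regular `*`-semigroup: a semigroup with a unary operation `*` satisfying `(a*)* = a`,
`(ab)* = b* a*` and `a a* a = a`. -/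
structure RegularStarSemigroup : Type (u + 1) where
  carrier : Type u
  [semigroup : Semigroup carrier]
  [starMul : StarMul carrier]
  mul_star_mul : ∀ a : carrier, a * star a * a = a

attribute [instance] RegularStarSemigroup.semigroup RegularStarSemigroup.starMul

namespace RegularStarSemigroup

/-- A `*`-semigroup homomorphism. -/
@[ext]
structure Hom (S T : RegularStarSemigroup.{u}) : Type u where
  toFun : S.carrier → T.carrier
  map_mul : ∀ a b, toFun (a * b) = toFun a * toFun b
  map_star : ∀ a, toFun (star a) = star (toFun a)

/-- The category of regular `*`-semigroups and `*`-semigroup homomorphisms. -/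
instance : Category RegularStarSemigroup.{u} where
  Hom := Hom
  id S := ⟨fun a => a, fun _ _ => rfl, fun _ => rfl⟩
  comp f g := ⟨fun a => g.toFun (f.toFun a),
    fun a b => (congrArg g.toFun (f.map_mul a b)).trans (g.map_mul _ _),
    fun a => (congrArg g.toFun (f.map_star a)).trans (g.map_star _)⟩

variable (S : RegularStarSemigroup.{u})

/-- The set `P(S)` of projections of `S`. -/
def proj : Set S.carrier := {p | p * p = p ∧ star p = p}

theorem conj_mem_proj {p q : S.carrier} (hp : p ∈ S.proj) (hq : q ∈ S.proj) :
    p * q * p ∈ S.proj := by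
  have h1 := S.mul_star_mul (p * q)
  rw [star_mul, hp.2, hq.2] at h1
  refine ⟨?_, ?_⟩
  · calc p * q * p * (p * q * p) = p * q * (p * p) * q * p := by simp only [mul_assoc]
      _ = p * (q * q) * (p * p) * q * p := by rw [hp.1, hq.1]
      _ = p * q * (q * p) * (p * q) * p := by simp only [mul_assoc]
      _ = p * q * p := by rw [h1]
  · rw [star_mul, star_mul, hp.2, hq.2, mul_assoc]

/-- The operations of the projection algebra `P(S)`: `q θ_p = p q p`. -/
def projTh (p q : S.proj) : S.proj := ⟨p * q * p, S.conj_mem_proj p.2 q.2⟩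

/-- The product `p₁ ⋯ p_k` of the entries of a path. -/
def pathProd (p : Path S.projTh) : S.carrier :=
  p.tail.foldl (fun (x : S.carrier) (q : S.proj) => x * q.1) p.head.1

theorem foldl_mul (l : List S.proj) (x y : S.carrier) :
    l.foldl (fun (x : S.carrier) (q : S.proj) => x * q.1) (x * y) =
      x * l.foldl (fun (x : S.carrier) (q : S.proj) => x * q.1) y := by
  induction l generalizing y with
  | nil => rfl
  | cons a l ih => rw [List.foldl_cons, List.foldl_cons, mul_assoc, ih]

theorem pathProd_mul_last (p : Path S.projTh) : S.pathProd p * p.last = S.pathProd p := by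
  obtain ⟨p₁, l, hp⟩ := p
  change l.foldl (fun (x : S.carrier) (q : S.proj) => x * q.1) p₁.1 * (l.getLastD p₁ : S.proj) =
    l.foldl (fun (x : S.carrier) (q : S.proj) => x * q.1) p₁.1
  clear hp
  have key : ∀ (l : List S.proj) (p₁ : S.proj) (x : S.carrier), x * p₁ = x →
      l.foldl (fun (x : S.carrier) (q : S.proj) => x * q.1) x * (l.getLastD p₁ : S.proj) =
        l.foldl (fun (x : S.carrier) (q : S.proj) => x * q.1) x := by
    intro l
    induction l with
    | nil => intro p₁ x hx; exact hx
    | cons a l ih =>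
      intro p₁ x _
      rw [List.foldl_cons, List.getLastD_cons]
      exact ih a _ (by rw [mul_assoc, a.2.1])
  exact key l p₁ p₁ p₁.2.1

theorem pathProd_comp (p q : Path S.projTh) (h : p.last = q.head) :
    S.pathProd (p.comp q h) = S.pathProd p * S.pathProd q := by
  change (p.tail ++ q.tail).foldl (fun (x : S.carrier) (q : S.proj) => x * q.1) p.head.1 = _
  rw [List.foldl_append]
  have h1 : S.pathProd p * q.head.1 = S.pathProd p := by
    rw [← h]; exact S.pathProd_mul_last p
  change q.tail.foldl _ (S.pathProd p) = _
  exact (congrArg (fun t => q.tail.foldl (fun (x : S.carrier) (q : S.proj) => x * q.1) t)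
    h1.symm).trans (S.foldl_mul _ _ _)

theorem pathProd_eq_of_approx {p q : Path S.projTh} (h : Path.Approx S.projTh p q) :
    S.pathProd p = S.pathProd q := by
  induction h with
  | om₁ p h => exact p.2.1
  | om₂ p q h => exact (congrArg Subtype.val h.1).symm
  | refl => rfl
  | symm _ ih => exact ih.symm
  | trans _ _ ih₁ ih₂ => exact ih₁.trans ih₂
  | comp_left u hp hq _ ih => rw [pathProd_comp, pathProd_comp, ih]
  | comp_right v hp hq _ ih => rw [pathProd_comp, pathProd_comp, ih]

/-- The data of the chained projection groupoid `(P(S), G(S), ε(S))` of a regular `*`-semigroup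
`S`: the morphisms are the elements of `S`, the objects are the projections, an element `a` is a
morphism from `a a*` to `a* a`, composition and inversion are the restriction of the product of
`S` and the unary operation of `S`, the order is given by `a ≤ b` iff `a = p b` for some projection
`p ≤ b b*`, and `ε[p₁, …, p_k] = p₁ ⋯ p_k`. -/
abbrev toData : ChainedProjectionGroupoidData S.carrier where
  obj := S.proj
  dom a := a * star a
  cod a := star a * a
  comp a b _ := a * b
  inv a := star a
  le a b := ∃ p ∈ S.proj, p = b * star b * p * (b * star b) ∧ a = p * b
  th := S.projTh
  eval := Quotient.lift S.pathProd (fun _ _ h => S.pathProd_eq_of_approx h)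

end RegularStarSemigroup

/-! ### The two functors -/

/-- The axioms of a regular `*`-semigroup, for a binary and a unary operation on a set. -/
structure IsRegularStar {S : Type u} (mul : S → S → S) (st : S → S) : Prop where
  mul_assoc : ∀ a b c, mul (mul a b) c = mul a (mul b c)
  star_star : ∀ a, st (st a) = a
  star_mul : ∀ a b, st (mul a b) = mul (st b) (st a)
  mul_star_mul : ∀ a, mul (mul a (st a)) a = a

/-- The regular `*`-semigroup with given operations. -/
abbrev RegularStarSemigroup.of {S : Type u} (mul : S → S → S) (st : S → S)
    (h : IsRegularStar mul st) : RegularStarSemigroup.{u} :=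
  letI : Semigroup S := { mul := mul, mul_assoc := h.mul_assoc }
  letI : StarMul S :=
    { star := st, star_involutive := h.star_star, star_mul := h.star_mul }
  { carrier := S, mul_star_mul := h.mul_star_mul }

/-- The product of a chained projection groupoid. -/
noncomputable def ChainedProjectionGroupoid.pr (X : ChainedProjectionGroupoid.{u})
    (a b : X.carrier) : X.carrier :=
  X.isChainedProjectionGroupoid.toIsWeakChainedProjectionGroupoid.pr a b

/-- The functor `𝐆` from regular `*`-semigroups to chained projection groupoids, given by
`S ↦ (P(S), G(S), ε(S))` on objects and acting identically on morphisms.  The two hypotheses state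
that it is well defined on objects and on morphisms. -/
def functorG
    (hobj : ∀ S : RegularStarSemigroup.{u}, S.toData.IsChainedProjectionGroupoid)
    (hmap : ∀ (S T : RegularStarSemigroup.{u}) (φ : S ⟶ T),
      IsChainedProjectionFunctor S.toData T.toData φ.toFun) :
    RegularStarSemigroup.{u} ⥤ ChainedProjectionGroupoid.{u} where
  obj S := ⟨S.carrier, S.toData, hobj S⟩
  map {S T} φ := ⟨φ.toFun, hmap S T φ⟩

/-- The functor `𝐒` from chained projection groupoids to regular `*`-semigroups, sending
`(P, G, ε)` to the set `G` with the product `pr` and the inversion of `G`, and acting identically on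
morphisms.  The two hypotheses state that it is well defined on objects and on morphisms. -/
noncomputable def functorS
    (hobj : ∀ X : ChainedProjectionGroupoid.{u}, IsRegularStar X.pr X.data.inv)
    (hmap : ∀ (X Y : ChainedProjectionGroupoid.{u}) (φ : X ⟶ Y),
      (∀ a b, φ.toFun (X.pr a b) = Y.pr (φ.toFun a) (φ.toFun b)) ∧
        ∀ a, φ.toFun (X.data.inv a) = Y.data.inv (φ.toFun a)) :
    ChainedProjectionGroupoid.{u} ⥤ RegularStarSemigroup.{u} where
  obj X := RegularStarSemigroup.of X.pr X.data.inv (hobj X)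
  map {X Y} φ := ⟨φ.toFun, (hmap X Y φ).1, (hmap X Y φ).2⟩

end RegStar

namespace RegStar

/-! ### From regular `*`-semigroups to chained projection groupoids -/

namespace RegularStarSemigroup

section Words

variable {S : RegularStarSemigroup.{u}}

/-! From semigroups to groupoids: in a regular `*`-semigroup a product of two projections is
idempotent (`proj_mul_proj_idem`), and this reduces the axioms to identities between words. The
restriction of `a` to a projection `p ≤ aa*` is `pa`, hence `pΘ_a = a*pa`; along a path the product
of the entries behaves like a morphism from first to last entry; and both sides of the coherence
condition collapse to `ebf` (`lam_eq`, `rho_eq`).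

From groupoids to semigroups: the hard point is associativity. Put `p = r(a)`, `s = d(c)`, `e =
sΘ_{b⁻¹}θ_p` and `f = pΘ_bθ_s`. The pair `(e, f)` is `b`-linked, and `(a • b) • c` is the composite
of `a` restricted to range `e`, the morphism `λ(e, b, f)`, and `c` restricted to domain `f`
(`pr_pr_eq`). Inversion reverses products and turns `λ` for `b⁻¹` into `ρ` for `b`, so `a • (b • c)`
is the same composite with `ρ` in place of `λ`. Coherence is exactly `λ = ρ`.

Mutual inverseness: in `S` the product `a • b` is a word that collapses to `ab`. Conversely, the
objects, the operations `θ`, the order and `ε` of a chained projection groupoid can all be read off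
from `•` and inversion, so its identity map is a functor onto the groupoid rebuilt from the
semigroup, reflecting objects and order (`toData_of_eq`). Morphisms are never changed, so equality
of functors follows from equality on objects. -/

theorem mul_star_mul_self (a : S.carrier) : a * (star a * a) = a := by
  rw [← mul_assoc, S.mul_star_mul]

theorem mul_star_mul_self_assoc (a x : S.carrier) : a * (star a * (a * x)) = a * x := by
  rw [← mul_assoc, ← mul_assoc, S.mul_star_mul]

theorem star_mul_mul_star (a : S.carrier) : star a * (a * star a) = star a := by
  simpa using mul_star_mul_self (star a)

theorem star_mul_mul_star_assoc (a x : S.carrier) :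
    star a * (a * (star a * x)) = star a * x := by
  simpa using mul_star_mul_self_assoc (star a) x

theorem proj_mul_self (p : S.proj) : (p : S.carrier) * p = p := p.2.1

theorem proj_mul_self_assoc (p : S.proj) (x : S.carrier) : (p : S.carrier) * (p * x) = p * x := by
  rw [← mul_assoc, p.2.1]

theorem star_proj (p : S.proj) : star (p : S.carrier) = p := p.2.2

/-- Take `x = pq` in `x x* x = x`: since `x* = qp`, the left side is `pq · qp · pq = pqpq`. -/
theorem proj_mul_proj_idem (p q : S.proj) : (p : S.carrier) * (q * (p * q)) = p * q := by
  have h := mul_star_mul_self ((p : S.carrier) * (q : S.carrier))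
  simpa only [star_mul, star_proj, mul_assoc, proj_mul_self_assoc] using h

theorem proj_mul_proj_idem_assoc (p q : S.proj) (x : S.carrier) :
    (p : S.carrier) * (q * (p * ((q : S.carrier) * x))) = p * (q * x) := by
  simpa only [mul_assoc] using congrArg (· * x) (proj_mul_proj_idem p q)

theorem mul_star_mem_proj (a : S.carrier) : a * star a ∈ S.proj :=
  ⟨by rw [mul_assoc, star_mul_mul_star], by simp⟩

theorem star_mul_mem_proj (a : S.carrier) : star a * a ∈ S.proj :=
  ⟨by rw [mul_assoc, mul_star_mul_self], by simp⟩

theorem projTh_val (p q : S.proj) : (S.projTh p q : S.carrier) = p * (q * p) :=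
  mul_assoc _ _ _

/-- Because `p = p*p`, the element equals `(pa)*(pa)`. -/
theorem star_conj_mem_proj (a : S.carrier) (p : S.proj) : star a * (p * a) ∈ S.proj := by
  have h : star a * (p * a) = star ((p : S.carrier) * a) * (p * a) := by
    simp only [star_mul, star_proj, mul_assoc, proj_mul_self_assoc]
  rw [h]
  exact star_mul_mem_proj _

theorem fRel_iff {p q : S.proj} : FRel S.projTh p q ↔
    (p : S.carrier) = p * (q * p) ∧ (q : S.carrier) = q * (p * q) := by
  simp only [FRel, LeF, Subtype.ext_iff, projTh_val]

end Words

/-! ### The projection algebra and the order of a regular `*`-semigroup. -/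

variable (S : RegularStarSemigroup.{u})

theorem projTh_isProjectionAlgebra : IsProjectionAlgebra S.projTh where
  p1 p := by
    apply Subtype.ext
    simp only [projTh_val, proj_mul_self]
  p2 p x := by
    apply Subtype.ext
    simp only [projTh_val, mul_assoc, proj_mul_self, proj_mul_self_assoc]
  p3 p q := by
    apply Subtype.ext
    simp only [projTh_val, mul_assoc, proj_mul_proj_idem_assoc]
  p4 p q x := by
    apply Subtype.ext
    simp only [projTh_val, mul_assoc]
  p5 p q x := by
    apply Subtype.ext
    simp only [projTh_val, mul_assoc, proj_mul_proj_idem, proj_mul_proj_idem_assoc]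

variable {S}

theorem ple_iff {p q : S.proj} : PLe S.projTh p q ↔ (p : S.carrier) = q * (p * q) := by
  simp only [PLe, Subtype.ext_iff, projTh_val]

/-- Replaces the sandwich condition on `p` by absorption on each side, which is the form used for
rewriting. -/
theorem le_iff {a b : S.carrier} : S.toData.le a b ↔
    ∃ p : S.proj, (p : S.carrier) * (b * star b) = p ∧ b * star b * p = p ∧ a = p * b := by
  constructor
  · rintro ⟨p, hp, h, rfl⟩
    refine ⟨⟨p, hp⟩, ?_, ?_, rfl⟩
    · change p * (b * star b) = p
      conv_lhs => rw [h]
      rw [mul_assoc _ (b * star b), (mul_star_mem_proj b).1, ← h]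
    · change (b * star b) * p = p
      conv_lhs => rw [h]
      rw [mul_assoc (b * star b), ← mul_assoc, (mul_star_mem_proj b).1, ← mul_assoc, ← h]
  · rintro ⟨p, h1, h2, rfl⟩
    exact ⟨p, p.2, by rw [h2, h1], rfl⟩

theorem le_iff_ple {p q : S.proj} : S.toData.le p q ↔ PLe S.projTh p q := by
  rw [le_iff, ple_iff]
  simp only [star_proj, proj_mul_self]
  constructor
  · rintro ⟨r, h1, h2, h3⟩
    rw [h1] at h3
    rw [h3, h1, h2]
  · intro h
    refine ⟨p, ?_, ?_, ?_⟩
    · conv_lhs => rw [h]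
      simp only [mul_assoc, proj_mul_self]
      exact h.symm
    · conv_lhs => rw [h]
      rw [proj_mul_self_assoc]
      exact h.symm
    · conv_rhs => rw [h]
      simp only [mul_assoc, proj_mul_self]
      exact h

theorem mul_star_of_le {p : S.proj} {b : S.carrier} (h : (p : S.carrier) * (b * star b) = p) :
    (p * b) * star (p * b) = (p : S.carrier) := by
  rw [star_mul, star_proj, mul_assoc, ← mul_assoc b, ← mul_assoc, h, proj_mul_self]

/-! ### The ordered groupoid of a regular `*`-semigroup. -/

variable (S)

theorem toData_isCategory : S.toData.IsCategory where
  dom_mem := mul_star_mem_proj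
  cod_mem := star_mul_mem_proj
  dom_obj p hp := by
    change p * star p = p
    rw [hp.2, hp.1]
  cod_obj p hp := by
    change star p * p = p
    rw [hp.2, hp.1]
  dom_comp a b h := by
    change star a * a = b * star b at h
    change a * b * star (a * b) = a * star a
    rw [star_mul, mul_assoc, ← mul_assoc b, ← h, mul_assoc, mul_star_mul_self_assoc]
  cod_comp a b h := by
    change star a * a = b * star b at h
    change star (a * b) * (a * b) = star b * b
    rw [star_mul, mul_assoc, ← mul_assoc (star a), h, mul_assoc, star_mul_mul_star_assoc]
  id_comp a := S.mul_star_mul a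
  comp_id a := mul_star_mul_self a
  assoc a b c _ _ := mul_assoc a b c

theorem toData_isGroupoid : S.toData.IsGroupoid where
  __ := S.toData_isCategory
  dom_inv a := by
    change star a * star (star a) = star a * a
    rw [star_star]
  cod_inv a := by
    change star (star a) * star a = a * star a
    rw [star_star]
  inv_inv := star_star
  inv_comp a b _ := star_mul a b
  comp_inv a := rfl

theorem toData_isOrderedGroupoid : S.toData.IsOrderedGroupoid where
  __ := S.toData_isGroupoid
  le_refl a := le_iff.2 ⟨⟨_, mul_star_mem_proj a⟩, (mul_star_mem_proj a).1,
    (mul_star_mem_proj a).1, (S.mul_star_mul a).symm⟩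
  le_antisymm a b hab hba := by
    obtain ⟨p, h1, h2, rfl⟩ := le_iff.1 hab
    obtain ⟨q, h3, h4, h5⟩ := le_iff.1 hba
    rw [mul_star_of_le h1] at h3 h4
    rw [← mul_assoc, h3] at h5
    conv_lhs => rw [h5, ← mul_assoc, h4]
    exact h5.symm
  le_trans a b c hab hbc := by
    obtain ⟨q, h3, h4, rfl⟩ := le_iff.1 hbc
    obtain ⟨p, h1, h2, rfl⟩ := le_iff.1 hab
    rw [mul_star_of_le h3] at h1 h2
    refine le_iff.2 ⟨p, ?_, ?_, ?_⟩
    · rw [← h1, mul_assoc, h3]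
    · rw [← h2, ← mul_assoc, h4]
    · rw [← mul_assoc, h1]
  dom_le a b hab := by
    obtain ⟨p, h1, h2, rfl⟩ := le_iff.1 hab
    change S.toData.le ((p * b) * star (p * b)) (b * star b)
    rw [mul_star_of_le h1]
    refine le_iff.2 ⟨p, ?_, ?_, h1.symm⟩
    · rw [(mul_star_mem_proj b).2, (mul_star_mem_proj b).1, h1]
    · rw [(mul_star_mem_proj b).2, (mul_star_mem_proj b).1, h2]
  cod_le a b hab := by
    obtain ⟨p, h1, h2, rfl⟩ := le_iff.1 hab
    change S.toData.le (star (p * b) * (p * b)) (star b * b)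
    have e : star (p * b) * (p * b) = star b * (p * b) := by
      simp only [star_mul, star_proj, mul_assoc, proj_mul_self_assoc]
    rw [e]
    -- The range of `pb` is the projection `b*pb`, which serves as its own witness below `b*b`.
    refine le_iff.2 ⟨⟨_, star_conj_mem_proj b p⟩, ?_, ?_, ?_⟩ <;>
    simp only [star_mul, star_star, mul_assoc, mul_star_mul_self,
      star_mul_mul_star_assoc]
  inv_le a b hab := by
    obtain ⟨p, h1, h2, rfl⟩ := le_iff.1 hab
    change S.toData.le (star (p * b)) (star b)
    -- A right restriction becomes a left one: `(pb)* = b*p = (b*pb)b*`.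
    refine le_iff.2 ⟨⟨_, star_conj_mem_proj b p⟩, ?_, ?_, ?_⟩
    · simp only [star_star, mul_assoc, mul_star_mul_self]
    · simp only [star_star, mul_assoc, star_mul_mul_star_assoc]
    · simp only [star_mul, star_proj, mul_assoc, h1]
  comp_le a b c d hac hbd hab hcd := by
    change star a * a = c * star c at hac
    change star b * b = d * star d at hbd
    change S.toData.le (a * c) (b * d)
    obtain ⟨p, h1, h2, rfl⟩ := le_iff.1 hab
    obtain ⟨q, h3, h4, rfl⟩ := le_iff.1 hcd
    rw [mul_star_of_le h3] at hac
    have e : b * d * star (b * d) = b * star b := by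
      rw [star_mul, mul_assoc, ← mul_assoc d, ← hbd, mul_assoc, mul_star_mul_self_assoc]
    refine le_iff.2 ⟨p, by rw [e, h1], by rw [e, h2], ?_⟩
    -- Composability forces `q = (pb)*(pb)`, and `pb` absorbs this on its right, leaving `p(bd)`.
    rw [← hac]
    simp only [star_mul, star_proj, mul_assoc, proj_mul_self_assoc]
    have h5 (x : S.carrier) : (p : S.carrier) * (b * (star b * x)) = p * x := by
      rw [← mul_assoc b, ← mul_assoc, h1]
    simp only [h5, proj_mul_self_assoc]
  existsUnique_restriction a p hp hpa := by
    lift p to S.proj using hp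
    obtain ⟨r, h1, h2, h3⟩ := le_iff.1 hpa
    change (r : S.carrier) * (a * star a * star (a * star a)) = r at h1
    change a * star a * star (a * star a) * r = (r : S.carrier) at h2
    change (p : S.carrier) = r * (a * star a) at h3
    rw [(mul_star_mem_proj a).2, (mul_star_mem_proj a).1] at h1 h2
    rw [h1] at h3
    rw [← h3] at h1 h2
    -- The restriction is `pa`; it is unique because any `qa ≤ a` has domain `q`.
    refine ⟨p * a, ⟨le_iff.2 ⟨p, h1, h2, rfl⟩, mul_star_of_le h1⟩, ?_⟩
    rintro u ⟨hu, hup⟩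
    obtain ⟨q, h4, h5, rfl⟩ := le_iff.1 hu
    change q * a * star (q * a) = (p : S.carrier) at hup
    rw [mul_star_of_le h4] at hup
    rw [hup]

theorem toData_isWeakProjectionGroupoid :
    S.toData.toProjectionGroupoidData.IsWeakProjectionGroupoid where
  __ := S.toData_isOrderedGroupoid
  isProjectionAlgebra := S.projTh_isProjectionAlgebra
  le_iff_ple _ _ := le_iff_ple

/-! ### Restrictions and the maps `Θ_a` as products. -/

variable {S}

/-- Stated for an arbitrary proof `h`, so that it applies to restrictions inside any of the larger
structures. -/
theorem lres_eq_of_isOrderedGroupoid (h : S.toData.IsOrderedGroupoid) (a : S.carrier) (p : S.proj)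
    (hp : S.toData.le p (S.toData.dom a)) : h.lres a p hp = p * a := by
  obtain ⟨q, h1, h2, h3⟩ := le_iff.1 (h.lres_le a p hp)
  have h4 : h.lres a p hp * star (h.lres a p hp) = p := h.dom_lres a p hp
  rw [h3, mul_star_of_le h1] at h4
  rw [h3, h4]

theorem rres_eq_of_isOrderedGroupoid (h : S.toData.IsOrderedGroupoid) (a : S.carrier) (p : S.proj)
    (hp : S.toData.le p (S.toData.cod a)) : h.rres a p hp = a * p := by
  change star (h.lres (star a) p _) = a * p
  rw [lres_eq_of_isOrderedGroupoid, star_mul, star_star, star_proj]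

theorem Th_val (h : S.toData.toProjectionGroupoidData.IsWeakProjectionGroupoid) (a : S.carrier)
    (p : S.proj) : (h.Th a p : S.carrier) = star a * (p * a) := by
  change star (h.lres a _ _) * h.lres a _ _ = _
  rw [lres_eq_of_isOrderedGroupoid]
  change star ((S.projTh (h.domO a) p : S.proj) * a) * ((S.projTh (h.domO a) p : S.proj) * a) = _
  rw [star_mul, star_proj, mul_assoc, proj_mul_self_assoc, projTh_val]
  change star a * (a * star a * (p * (a * star a)) * a) = _
  simp only [mul_assoc, mul_star_mul_self, star_mul_mul_star_assoc]

variable (S)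

theorem toData_isProjectionGroupoid :
    S.toData.toProjectionGroupoidData.IsProjectionGroupoid where
  __ := S.toData_isWeakProjectionGroupoid
  th_Th a p x := by
    apply Subtype.ext
    rw [Th_val]
    erw [projTh_val, projTh_val]
    rw [Th_val, Th_val]
    change _ = star a * (p * (star (star a) * (x * star a) * p) * a)
    simp only [star_star, mul_assoc]

/-! ### Products along paths. -/

variable {S}

theorem pathProd_mk_cons (p q : S.proj) (l : List S.proj) (h h') :
    S.pathProd ⟨p, q :: l, h⟩ = p * S.pathProd ⟨q, l, h'⟩ :=
  S.foldl_mul l p q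

theorem head_mul_pathProd (c : Path S.projTh) :
    (c.head : S.carrier) * S.pathProd c = S.pathProd c := by
  obtain ⟨p, l, h⟩ := c
  cases l with
  | nil => exact p.2.1
  | cons q l => rw [pathProd_mk_cons _ _ _ _ (List.isChain_cons_cons.1 h).2, proj_mul_self_assoc]

/-- Induction on the path: if `w` is the product from `q` on, then `(pw)(pw)* = p(ww*)p = pqp = p`,
since `p F q`. -/
theorem pathProd_mul_star (c : Path S.projTh) :
    S.pathProd c * star (S.pathProd c) = c.head := by
  obtain ⟨p, l, h⟩ := c
  induction l generalizing p with
  | nil =>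
    change (p : S.carrier) * star (p : S.carrier) = p
    rw [star_proj, proj_mul_self]
  | cons q l ih =>
    have hc := List.isChain_cons_cons.1 h
    rw [pathProd_mk_cons _ _ _ _ hc.2, star_mul, star_proj, mul_assoc, ← mul_assoc (S.pathProd _),
      ih]
    exact (fRel_iff.1 hc.1).1.symm

/-- With `w = qw` the product from `q` on, `(pw)*(pw) = w*(qpq)w = w*w`, which reduces to the
shorter path. -/
theorem star_mul_pathProd (c : Path S.projTh) :
    star (S.pathProd c) * S.pathProd c = c.last := by
  obtain ⟨p, l, h⟩ := c
  induction l generalizing p with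
  | nil =>
    change star (p : S.carrier) * (p : S.carrier) = p
    rw [star_proj, proj_mul_self]
  | cons q l ih =>
    have hc := List.isChain_cons_cons.1 h
    have hl : (⟨p, q :: l, h⟩ : Path S.projTh).last = (⟨q, l, hc.2⟩ : Path S.projTh).last :=
      List.getLastD_cons
    rw [pathProd_mk_cons _ _ _ _ hc.2, hl, ← ih q hc.2]
    have h1 : (q : S.carrier) * S.pathProd ⟨q, l, hc.2⟩ = S.pathProd ⟨q, l, hc.2⟩ :=
      head_mul_pathProd ⟨q, l, hc.2⟩
    have h2 : star (S.pathProd ⟨q, l, hc.2⟩) * (q : S.carrier) = star (S.pathProd ⟨q, l, hc.2⟩) := by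
      simpa only [star_mul, star_proj] using congrArg star h1
    rw [star_mul, star_proj, mul_assoc, proj_mul_self_assoc]
    conv_lhs => rw [← h2, ← h1]
    rw [mul_assoc, ← mul_assoc (p : S.carrier), ← mul_assoc (q : S.carrier),
      ← (fRel_iff.1 hc.1).2, h1]

/-- In the inductive step `w = rw` is the product from `r` on, and `q · rqr · w = (qr)(qr)w = qrw`.
-/
theorem pathProd_restrict (c : Path S.projTh) (q : S.proj) (hq : PLe S.projTh q c.head) :
    S.pathProd (c.restrict S.projTh_isProjectionAlgebra q hq) = q * S.pathProd c := by
  obtain ⟨p, l, h⟩ := c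
  induction l generalizing p q with
  | nil =>
    change (q : S.carrier) = q * p
    have h1 := ple_iff.1 hq
    change (q : S.carrier) = p * (q * p) at h1
    conv_rhs => rw [h1]
    simp only [mul_assoc, proj_mul_self]
    exact h1
  | cons r l ih =>
    have hc := List.isChain_cons_cons.1 h
    have hr : PLe S.projTh (S.projTh r q) r := S.projTh_isProjectionAlgebra.ple_th r q
    have hqp : (q : S.carrier) * p = q := by
      have h1 := ple_iff.1 hq
      change (q : S.carrier) = p * (q * p) at h1
      conv_lhs => rw [h1]
      simp only [mul_assoc, proj_mul_self]
      exact h1.symm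
    have h1 := ih (S.projTh r q) r hc.2 hr
    have h2 : S.pathProd (Path.restrict S.projTh_isProjectionAlgebra ⟨p, r :: l, h⟩ q hq) =
        q * S.pathProd (Path.restrict S.projTh_isProjectionAlgebra ⟨r, l, hc.2⟩
          (S.projTh r q) hr) := S.foldl_mul _ _ _
    have h3 : (r : S.carrier) * S.pathProd ⟨r, l, hc.2⟩ = S.pathProd ⟨r, l, hc.2⟩ :=
      head_mul_pathProd ⟨r, l, hc.2⟩
    rw [h2, h1, pathProd_mk_cons _ _ _ _ hc.2, ← mul_assoc (q : S.carrier) (p : S.carrier), hqp,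
      projTh_val, ← h3]
    simp only [mul_assoc, proj_mul_self_assoc, proj_mul_proj_idem_assoc]

variable (S)

theorem toData_isWeakChainedProjectionGroupoid :
    S.toData.IsWeakChainedProjectionGroupoid where
  __ := S.toData_isProjectionGroupoid
  dom_eval c := Quotient.inductionOn c pathProd_mul_star
  cod_eval c := Quotient.inductionOn c star_mul_pathProd
  eval_single _ := rfl
  eval_comp c d := Quotient.inductionOn₂ c d fun p q hpq =>
    (congrArg S.toData.eval (Chain.mk_comp_mk p q hpq)).trans (S.pathProd_comp p q hpq)
  eval_le := by
    rintro _ _ ⟨_, c, rfl, rfl, q, hq, rfl⟩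
    change S.toData.le (S.pathProd _) (S.pathProd c)
    have h1 := ple_iff.1 hq
    refine ⟨q, q.2, ?_, pathProd_restrict c q hq⟩
    rw [pathProd_mul_star, mul_assoc]
    exact h1

/-! ### Coherence, and homomorphisms as functors. -/

variable {S}

theorem evalPair_eq (h : S.toData.IsWeakChainedProjectionGroupoid) (p q : S.proj)
    (hpq : FRel S.projTh p q) : h.evalPair p q hpq = p * q := rfl

/-- With `d = bb*` the word reduces to `e d e d e b f`; since `db = b` and `ed` is idempotent, only
`ebf` remains. `rho_eq` reaches the same word through `b*b` and `f`, whence coherence. -/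
theorem lam_eq (h : S.toData.IsWeakChainedProjectionGroupoid) (b : S.carrier) (e f : S.proj)
    (hl : h.Linked b e f) : h.lam b e f hl = e * (b * f) := by
  change h.evalPair _ _ _ * h.lres _ _ _ * h.evalPair _ _ _ = _
  rw [lres_eq_of_isOrderedGroupoid]
  erw [evalPair_eq, evalPair_eq]
  rw [Th_val]
  erw [projTh_val]
  change e * (b * star b * (e * (b * star b))) * (b * star b * (e * (b * star b)) * b) *
    (star b * (e * b) * f) = _
  have hd' := proj_mul_proj_idem_assoc e ⟨_, mul_star_mem_proj b⟩
  simp only [mul_assoc] at hd'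
  have hd2 := hd' (b * f)
  simp only [mul_star_mul_self_assoc] at hd2
  simp only [mul_assoc, star_mul_mul_star_assoc, hd', hd2]

theorem rho_eq (h : S.toData.IsWeakChainedProjectionGroupoid) (b : S.carrier) (e f : S.proj)
    (hl : h.Linked b e f) : h.rho b e f hl = e * (b * f) := by
  change h.evalPair _ _ _ * h.rres _ _ _ * h.evalPair _ _ _ = _
  rw [rres_eq_of_isOrderedGroupoid]
  erw [evalPair_eq, evalPair_eq]
  rw [Th_val]
  erw [projTh_val]
  change e * (star (star b) * (f * star b)) * (b * (star b * b * (f * (star b * b)))) *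
    ((star b * b * (f * (star b * b))) * f) = _
  have hd := proj_mul_proj_idem ⟨_, star_mul_mem_proj b⟩ f
  simp only [mul_assoc] at hd
  have hd2 := congrArg (b * ·) hd
  simp only [mul_star_mul_self_assoc] at hd2
  simp only [star_star, mul_assoc, mul_star_mul_self_assoc, hd2]

theorem toData_isChainedProjectionGroupoid : S.toData.IsChainedProjectionGroupoid where
  __ := S.toData_isWeakChainedProjectionGroupoid
  coherent b e f hl := (lam_eq _ b e f hl).trans (rho_eq _ b e f hl).symm

theorem isChainedProjectionFunctor_toFun {S T : RegularStarSemigroup.{u}} (φ : S ⟶ T) :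
    IsChainedProjectionFunctor S.toData T.toData φ.toFun where
  map_obj p hp := ⟨by rw [← φ.map_mul, hp.1], by rw [← φ.map_star, hp.2]⟩
  map_dom a := by
    change φ.toFun (a * star a) = φ.toFun a * star (φ.toFun a)
    rw [φ.map_mul, φ.map_star]
  map_cod a := by
    change φ.toFun (star a * a) = star (φ.toFun a) * φ.toFun a
    rw [φ.map_mul, φ.map_star]
  map_comp a b _ := φ.map_mul a b
  map_le := by
    rintro a b ⟨p, hp, h1, rfl⟩
    refine ⟨φ.toFun p, ⟨by rw [← φ.map_mul, hp.1], by rw [← φ.map_star, hp.2]⟩, ?_, φ.map_mul _ _⟩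
    rw [← φ.map_star]
    simp only [← φ.map_mul]
    exact congrArg _ h1
  map_th p q := by
    apply Subtype.ext
    change φ.toFun (q * p * q) = φ.toFun q * φ.toFun p * φ.toFun q
    simp only [φ.map_mul]
  map_eval c := by
    induction c using Quotient.inductionOn with
    | h c =>
      obtain ⟨p, l, h⟩ := c
      change φ.toFun (l.foldl (fun (x : S.carrier) (q : S.proj) => x * q.1) p.1) =
        (l.map _).foldl (fun (x : T.carrier) (q : T.proj) => x * q.1) (φ.toFun p.1)
      clear h
      generalize p.1 = x
      induction l generalizing x with
      | nil => rfl
      | cons q l ih =>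
        rw [List.foldl_cons, List.map_cons, List.foldl_cons, ih, φ.map_mul]

end RegularStarSemigroup

end RegStar

namespace RegStar

/-! ### Restrictions in ordered groupoids -/

namespace OrderedGroupoidData

variable {G : Type u} {D : OrderedGroupoidData G}

/-- Composition carries a proof of composability, so its factors cannot be rewritten in place; this
lemma replaces them. -/
theorem comp_congr {a a' b b' : G} (ha : a = a') (hb : b = b') (h : D.cod a = D.dom b)
    (h' : D.cod a' = D.dom b') : D.comp a b h = D.comp a' b' h' := by
  subst ha hb
  rfl

theorem IsCategory.comp_eq_left (h : D.IsCategory) {a p : G} (hp : p ∈ D.obj)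
    (hap : D.cod a = D.dom p) : D.comp a p hap = a := by
  rw [← comp_congr rfl (hap.trans (h.dom_obj p hp)) (h.dom_obj _ (h.cod_mem a)).symm hap,
    h.comp_id]

theorem IsCategory.comp_eq_right (h : D.IsCategory) {a p : G} (hp : p ∈ D.obj)
    (hpa : D.cod p = D.dom a) : D.comp p a hpa = a := by
  rw [← comp_congr (hpa.symm.trans (h.cod_obj p hp)) rfl (h.cod_obj _ (h.dom_mem a)) hpa,
    h.id_comp]

namespace IsGroupoid

variable (h : D.IsGroupoid)
include h

/-- Compute `a⁻¹ ∘ (a ∘ b)` in two ways. -/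
theorem eq_inv_of_comp_eq {a b : G} (hab : D.cod a = D.dom b) (hc : D.comp a b hab ∈ D.obj) :
    b = D.inv a := by
  have h1 : D.comp (D.inv a) (D.comp a b hab) ((h.cod_inv a).trans (h.dom_comp a b hab).symm) =
      b := by
    rw [← h.assoc _ _ _ (h.cod_inv a) hab]
    refine h.comp_eq_right ?_ _
    have h2 := h.comp_inv (D.inv a)
    rw [comp_congr rfl (h.inv_inv a) _ (h.cod_inv a)] at h2
    rw [h2]
    exact h.dom_mem _
  rw [← h1]
  exact h.comp_eq_left hc _

theorem inv_obj {p : G} (hp : p ∈ D.obj) : D.inv p = p := by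
  have h1 : D.cod p = D.dom p := (h.cod_obj p hp).trans (h.dom_obj p hp).symm
  refine (h.eq_inv_of_comp_eq h1 ?_).symm
  rw [h.comp_eq_left hp]
  exact hp

end IsGroupoid

namespace IsOrderedGroupoid

variable (h : D.IsOrderedGroupoid)
include h

theorem eq_of_le_of_dom_eq {a u v : G} (hu : D.le u a) (hv : D.le v a) (huv : D.dom u = D.dom v) :
    u = v :=
  (h.existsUnique_restriction a _ (h.dom_mem u) (h.dom_le _ _ hu)).unique ⟨hu, rfl⟩
    ⟨hv, huv.symm⟩

theorem eq_of_le_of_cod_eq {a u v : G} (hu : D.le u a) (hv : D.le v a) (huv : D.cod u = D.cod v) :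
    u = v := by
  rw [← h.inv_inv u, ← h.inv_inv v, h.eq_of_le_of_dom_eq (h.inv_le _ _ hu) (h.inv_le _ _ hv)]
  rw [h.dom_inv, h.dom_inv, huv]

/-- The restriction of `v` to `d(u)` lies below `a` and has the same domain as `u`, so it is `u`. -/
theorem le_of_le_of_dom_le {a u v : G} (hu : D.le u a) (hv : D.le v a)
    (huv : D.le (D.dom u) (D.dom v)) : D.le u v := by
  obtain ⟨w, ⟨hw, hd⟩, -⟩ := h.existsUnique_restriction v _ (h.dom_mem u) huv
  rwa [h.eq_of_le_of_dom_eq hu (h.le_trans _ _ _ hw hv) hd.symm]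

theorem le_of_le_of_cod_le {a u v : G} (hu : D.le u a) (hv : D.le v a)
    (huv : D.le (D.cod u) (D.cod v)) : D.le u v := by
  rw [← h.inv_inv u, ← h.inv_inv v]
  refine h.inv_le _ _ (h.le_of_le_of_dom_le (h.inv_le _ _ hu) (h.inv_le _ _ hv) ?_)
  rwa [h.dom_inv, h.dom_inv]

theorem rres_le (a : G) (q : D.obj) (hq : D.le q (D.cod a)) : D.le (h.rres a q hq) a := by
  have h1 := h.inv_le _ _ (h.lres_le (D.inv a) q (h.le_dom_inv hq))
  rwa [h.inv_inv] at h1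

end IsOrderedGroupoid

end OrderedGroupoidData

/-! ### The regular `*`-semigroup of a chained projection groupoid -/

namespace ChainedProjectionGroupoidData.IsWeakChainedProjectionGroupoid

open OrderedGroupoidData

variable {G : Type u} {D : ChainedProjectionGroupoidData G}
  (h : D.IsWeakChainedProjectionGroupoid)

theorem codO_inv (a : G) : h.codO (D.inv a) = h.domO a := Subtype.ext (h.cod_inv a)

theorem fRel_self (h : D.IsWeakChainedProjectionGroupoid) (p : D.obj) : FRel D.th p p :=
  ⟨(h.isProjectionAlgebra.p1 p).symm, (h.isProjectionAlgebra.p1 p).symm⟩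

theorem evalPair_self (p : D.obj) (hp : FRel D.th p p) : h.evalPair p p hp = p := by
  have h1 : Chain.pair p p hp = Chain.single D.th p := Chain.mk_eq_mk.2 (.om₁ p hp)
  rw [evalPair, h1, h.eval_single]

theorem evalPair_congr {p p' q q' : D.obj} (hp : p = p') (hq : q = q') (hpq : FRel D.th p q)
    (hpq' : FRel D.th p' q') : h.evalPair p q hpq = h.evalPair p' q' hpq' := by
  subst hp hq
  rfl

/-- This is where the relation `[p, q, p] = [p]` of the chain groupoid is used. -/
theorem inv_evalPair (p q : D.obj) (hpq : FRel D.th p q) :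
    D.inv (h.evalPair p q hpq) = h.evalPair q p hpq.symm := by
  symm
  refine h.eq_inv_of_comp_eq ((h.cod_evalPair _ _ _).trans (h.dom_evalPair _ _ _).symm) ?_
  have h1 : (Chain.pair p q hpq).comp (Chain.pair q p hpq.symm) rfl = Chain.single D.th p :=
    (Chain.mk_comp_mk _ _ _).trans (Chain.mk_eq_mk.2 (.om₂ p q hpq))
  have h2 := h.eval_comp (Chain.pair p q hpq) (Chain.pair q p hpq.symm) rfl
  rw [h1, h.eval_single] at h2
  exact h2 ▸ p.2

/-- The path `(p, q)` restricts to `(r, rθ_q)`, and `ε` preserves order. -/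
theorem evalPair_le {p q r s : D.obj} (hpq : FRel D.th p q) (hrs : FRel D.th r s)
    (hrp : D.le r p) (hs : s = D.th q r) : D.le (h.evalPair r s hrs) (h.evalPair p q hpq) := by
  subst hs
  exact h.eval_le _ _ ⟨_, _, rfl, rfl, r, (h.le_iff_ple _ _).1 hrp, rfl⟩

section comp₃

variable {a b c a' b' c' : G}

theorem comp₃_congr (ha : a = a') (hb : b = b') (hc : c = c') (hab : D.cod a = D.dom b)
    (hbc : D.cod b = D.dom c) (hab' : D.cod a' = D.dom b') (hbc' : D.cod b' = D.dom c') :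
    h.comp₃ a b c hab hbc = h.comp₃ a' b' c' hab' hbc' := by
  subst ha hb hc
  rfl

theorem comp₃_eq_comp_comp (hab : D.cod a = D.dom b) (hbc : D.cod b = D.dom c) :
    h.comp₃ a b c hab hbc = D.comp a (D.comp b c hbc) (hab.trans (h.dom_comp b c hbc).symm) :=
  h.assoc a b c hab hbc

theorem dom_comp₃ (hab : D.cod a = D.dom b) (hbc : D.cod b = D.dom c) :
    D.dom (h.comp₃ a b c hab hbc) = D.dom a := by
  rw [comp₃, h.dom_comp, h.dom_comp]

theorem cod_comp₃ (hab : D.cod a = D.dom b) (hbc : D.cod b = D.dom c) :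
    D.cod (h.comp₃ a b c hab hbc) = D.cod c := by
  rw [comp₃, h.cod_comp]

theorem comp₃_le (hab : D.cod a = D.dom b) (hbc : D.cod b = D.dom c)
    (hab' : D.cod a' = D.dom b') (hbc' : D.cod b' = D.dom c') (ha : D.le a a') (hb : D.le b b')
    (hc : D.le c c') : D.le (h.comp₃ a b c hab hbc) (h.comp₃ a' b' c' hab' hbc') :=
  h.comp_le _ _ _ _ _ _ (h.comp_le _ _ _ _ _ _ ha hb) hc

theorem inv_comp₃ (hab : D.cod a = D.dom b) (hbc : D.cod b = D.dom c) :
    D.inv (h.comp₃ a b c hab hbc) = h.comp₃ (D.inv c) (D.inv b) (D.inv a)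
      ((h.cod_inv c).trans (hbc.symm.trans (h.dom_inv b).symm))
      ((h.cod_inv b).trans (hab.symm.trans (h.dom_inv a).symm)) := by
  rw [comp₃, comp₃_eq_comp_comp, h.inv_comp]
  exact comp_congr rfl (h.inv_comp a b hab) _ _

theorem comp₃_comp₃ {d e : G} (hab : D.cod a = D.dom b) (hbc : D.cod b = D.dom c)
    (h₁ : D.cod (h.comp₃ a b c hab hbc) = D.dom d) (hde : D.cod d = D.dom e)
    (hcd : D.cod c = D.dom d) (h₂ : D.cod a = D.dom (h.comp₃ b c d hbc hcd))
    (h₃ : D.cod (h.comp₃ b c d hbc hcd) = D.dom e) :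
    h.comp₃ (h.comp₃ a b c hab hbc) d e h₁ hde = h.comp₃ a (h.comp₃ b c d hbc hcd) e h₂ h₃ := by
  refine comp_congr ?_ rfl _ _
  have h₄ : D.cod a = D.dom (D.comp b c hbc) := hab.trans (h.dom_comp b c hbc).symm
  refine Eq.trans (comp_congr (h.assoc a b c hab hbc) rfl _ ?_)
    (h.assoc a (D.comp b c hbc) d h₄ ((h.cod_comp _ _ _).trans hcd))
  rw [h.cod_comp, h.cod_comp, hcd]

end comp₃

/-- The product `a • b` can be computed from any `u ≤ a` and `v ≤ b` with the appropriate range and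
domain. -/
theorem pr_eq {a b u v : G} {p q p' q' : D.obj} (hp : h.codO a = p) (hq : h.domO b = q)
    (hp' : p' = D.th p q) (hq' : q' = D.th q p) (hF : FRel D.th p' q') (hu : D.le u a)
    (hv : D.le v b) (hcu : D.cod u = p') (hdv : D.dom v = q')
    (h₁ : D.cod u = D.dom (h.evalPair p' q' hF)) (h₂ : D.cod (h.evalPair p' q' hF) = D.dom v) :
    h.pr a b = h.comp₃ u (h.evalPair p' q' hF) v h₁ h₂ := by
  -- The objects are separate variables tied by equations so that callers may supply equal but
  -- differently written ones; uniqueness of restrictions then identifies the outer factors.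
  subst hp hq hp' hq'
  refine h.comp₃_congr ?_ rfl ?_ _ _ _ _
  · exact h.eq_of_le_of_cod_eq (h.rres_le _ _ _) hu ((h.cod_rres _ _ _).trans hcu.symm)
  · exact h.eq_of_le_of_dom_eq (h.lres_le _ _ _) hv ((h.dom_lres _ _ _).trans hdv.symm)

theorem inv_pr (a b : G) : D.inv (h.pr a b) = h.pr (D.inv b) (D.inv a) := by
  refine (h.inv_comp₃ _ _).trans ?_
  have h₁ := h.inv_evalPair _ _ (h.isProjectionAlgebra.fRel_th (h.codO a) (h.domO b))
  rw [h.pr_eq (h.codO_inv b) (h.domO_inv a) rfl rfl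
    (h.isProjectionAlgebra.fRel_th (h.domO b) (h.codO a))
    (h.inv_le _ _ (h.lres_le b (D.th (h.domO b) (h.codO a)) (h.th_le _ _)))
    (h.inv_le _ _ (h.rres_le a (D.th (h.codO a) (h.domO b)) (h.th_le _ _)))
    (by rw [h.cod_inv, h.dom_lres]) (by rw [h.dom_inv, h.cod_rres])
    (by rw [h.cod_inv, h.dom_lres, h.dom_evalPair])
    (by rw [h.dom_inv, h.cod_rres, h.cod_evalPair])]
  exact h.comp₃_congr rfl h₁ rfl _ _ _ _

/-- Here the two middle projections coincide, so nothing is restricted and the connecting morphism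
`ε[p, p]` is an identity. -/
theorem pr_eq_comp {a b : G} (hab : D.cod a = D.dom b) : h.pr a b = D.comp a b hab := by
  have h1 : h.domO b = h.codO a := Subtype.ext hab.symm
  have h2 : h.codO a = D.th (h.codO a) (h.codO a) := (h.isProjectionAlgebra.p1 _).symm
  have h3 := h.evalPair_self (h.codO a) (h.fRel_self _)
  rw [h.pr_eq rfl h1 h2 h2 (h.fRel_self _) (h.le_refl a) (h.le_refl b) rfl hab.symm
    (h.dom_evalPair (h.codO a) _ _).symm ((h.cod_evalPair _ _ _).trans hab)]
  exact comp_congr (h.comp_eq_left (h3 ▸ h.cod_mem a) _) rfl _ _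

theorem pr_inv (a : G) : h.pr a (D.inv a) = D.dom a := by
  rw [h.pr_eq_comp (h.dom_inv a).symm, h.comp_inv]

theorem pr_dom_left (a : G) : h.pr (D.dom a) a = a := by
  rw [h.pr_eq_comp (h.cod_obj _ (h.dom_mem a)), h.id_comp]

theorem pr_inv_pr (a : G) : h.pr (h.pr a (D.inv a)) a = a := by
  rw [h.pr_inv, h.pr_dom_left]

theorem cod_pr (a b : G) : h.codO (h.pr a b) = h.Th b (h.codO a) :=
  Subtype.ext (h.cod_comp₃ _ _)

/-- By the identity for `θ_{pΘ_b}`, the image `eΘ_b` of the first entry is `sθ_{pΘ_b}`, which is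
`F`-related to `pΘ_bθ_s`; the other half is the same for `b⁻¹`. -/
theorem linked_th_Th (b : G) (p s : D.obj) :
    h.Linked b (D.th p (h.Th (D.inv b) s)) (D.th s (h.Th b p)) := by
  constructor
  · rw [← h.th_Th]
    exact (h.isProjectionAlgebra.fRel_th _ _).1
  · have h1 := h.th_Th (D.inv b) s p
    rw [h.inv_inv] at h1
    rw [← h1]
    exact (h.isProjectionAlgebra.fRel_th _ _).1

theorem dom_lam (b : G) (e f : D.obj) (hl : h.Linked b e f) : D.dom (h.lam b e f hl) = e :=
  (h.dom_comp₃ _ _).trans (h.dom_evalPair _ _ _)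

theorem cod_lam (b : G) (e f : D.obj) (hl : h.Linked b e f) : D.cod (h.lam b e f hl) = f :=
  (h.cod_comp₃ _ _).trans (h.cod_evalPair _ _ _)

/-- Inverting reverses the three factors and swaps left with right restriction, so `λ` and `ρ` are
mirror images. -/
theorem inv_lam_inv (b : G) (e f : D.obj) (hl : h.Linked b e f) :
    D.inv (h.lam (D.inv b) f e (ProjectionGroupoidData.IsProjectionGroupoid.Linked.symm _ hl)) =
      h.rho b e f hl := by
  refine (h.inv_comp₃ _ _).trans ?_
  refine h.comp₃_congr ?_ ?_ ?_ _ _ _ _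
  · exact h.inv_evalPair _ _ _
  · refine congrArg D.inv ?_
    refine h.eq_of_le_of_dom_eq (h.lres_le _ _ _) (h.lres_le _ _ _) ?_
    rw [h.dom_lres, h.dom_lres, h.domO_inv]
  · rw [h.inv_evalPair]
    exact h.evalPair_congr (by rw [h.domO_inv]) rfl _ _

/-- Multiplying `a • b` by `c` first restricts `a • b` to range `eΘ_b`. That restriction is `u ∘
ε[e, eθ_q] ∘ b'`, with `q = d(b)` and `b'` the restriction of `b` to `eθ_q`; appending `ε[eΘ_b, f]`
completes `λ(e, b, f)`. -/
theorem pr_pr_eq {a b c u v : G} {p s e f : D.obj} (hp : h.codO a = p) (hs : h.domO c = s)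
    (he : e = D.th p (h.Th (D.inv b) s)) (hf : f = D.th s (h.Th b p)) (hu : D.le u a)
    (hv : D.le v c) (hue : D.cod u = e) (hvf : D.dom v = f) (hl : h.Linked b e f)
    (h₁ : D.cod u = D.dom (h.lam b e f hl)) (h₂ : D.cod (h.lam b e f hl) = D.dom v) :
    h.pr (h.pr a b) c = h.comp₃ u (h.lam b e f hl) v h₁ h₂ := by
  have hA := h.isProjectionAlgebra
  have hq : PLe D.th (h.Th (D.inv b) s) (h.domO b) := by
    have h1 := h.Th_le (D.inv b) s
    rw [h.cod_inv] at h1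
    exact (h.le_iff_ple _ _).1 h1
  -- As `sΘ_{b⁻¹} ≤ q`, one has `e = sΘ_{b⁻¹}θ_qθ_p`, on which a further `θ_qθ_p` acts trivially.
  -- Hence `e` lies below the projection to which `a` is restricted in `a • b`.
  have hep : PLe D.th e (D.th p (h.domO b)) := by
    rw [PLe, ← hA.p4, he, hq, hA.p2, hA.p5]
  -- Restricting the connecting path of `a • b` to `e` ends at `eθ_{pθ_q}`, which must agree with
  -- the `eθ_q` occurring in `λ`.
  have he1 : D.th (h.domO b) e = D.th (D.th (h.domO b) p) e := by
    rw [← hA.p4, he, hA.p5]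
  have hf1 : h.Th b e = D.th (h.Th b p) s := by
    rw [h.th_Th, he]
  have h3 : D.cod u = D.dom (h.evalPair e (D.th (h.domO b) e) hl.fRel₁) :=
    hue.trans (h.dom_evalPair _ _ _).symm
  have h4 : D.cod (h.evalPair e (D.th (h.domO b) e) hl.fRel₁) =
      D.dom (h.lres b (D.th (h.domO b) e) (h.th_le _ _)) :=
    (h.cod_evalPair _ _ _).trans (h.dom_lres _ _ _).symm
  have h5 : D.cod (h.comp₃ u (h.evalPair e (D.th (h.domO b) e) hl.fRel₁)
      (h.lres b (D.th (h.domO b) e) (h.th_le _ _)) h3 h4) = h.Th b e := h.cod_comp₃ _ _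
  rw [h.pr_eq (p := h.Th b p) (u := h.comp₃ u (h.evalPair e (D.th (h.domO b) e) hl.fRel₁)
      (h.lres b (D.th (h.domO b) e) (h.th_le _ _)) h3 h4) (by rw [h.cod_pr, hp]) hs hf1 hf
      hl.fRel₃ ?_ hv h5 hvf (h5.trans (h.dom_evalPair _ _ _).symm)
      ((h.cod_evalPair _ _ _).trans hvf.symm)]
  · exact h.comp₃_comp₃ _ _ _ _ _ _ _
  -- The candidate is below `a • b` because each of its three factors is below the corresponding
  -- factor.
  · refine h.comp₃_le _ _ _ _ ?_ ?_ ?_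
    · refine h.le_of_le_of_cod_le hu (h.rres_le _ _ _) ?_
      rw [hue, h.cod_rres, hp]
      exact (h.le_iff_ple _ _).2 hep
    · refine h.evalPair_le _ _ ?_ ?_
      · rw [hp]
        exact (h.le_iff_ple _ _).2 hep
      · rw [hp]
        exact he1
    · refine h.le_of_le_of_dom_le (h.lres_le _ _ _) (h.lres_le _ _ _) ?_
      rw [h.dom_lres, h.dom_lres, hp, he1]
      exact h.th_le _ _

end ChainedProjectionGroupoidData.IsWeakChainedProjectionGroupoid

namespace ChainedProjectionGroupoidData.IsChainedProjectionGroupoid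

variable {G : Type u} {D : ChainedProjectionGroupoidData G}

theorem pr_assoc (h : D.IsChainedProjectionGroupoid) (a b c : G) :
    h.pr (h.pr a b) c = h.pr a (h.pr b c) := by
  have hl := h.linked_th_Th b (h.codO a) (h.domO c)
  have hpe : D.le (D.th (h.codO a) (h.Th (D.inv b) (h.domO c))) (D.cod a) := h.th_le _ _
  have hsf : D.le (D.th (h.domO c) (h.Th b (h.codO a))) (D.dom c) := h.th_le _ _
  have hu := h.rres_le a _ hpe
  have hv := h.lres_le c _ hsf
  have hue := h.cod_rres a _ hpe
  have hvf := h.dom_lres c _ hsf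
  rw [h.pr_pr_eq rfl rfl rfl rfl hu hv hue hvf hl (hue.trans (h.dom_lam _ _ _ hl).symm)
    ((h.cod_lam _ _ _ hl).trans hvf.symm)]
  have hl' := ProjectionGroupoidData.IsProjectionGroupoid.Linked.symm _ hl
  have hue' := (h.dom_inv _).trans hue
  have hvf' := (h.cod_inv _).trans hvf
  -- Now `a • (b • c)` is the inverse of `(c⁻¹ • b⁻¹) • a⁻¹`, to which `pr_pr_eq` applies with the
  -- linked pair reversed.
  rw [← h.inv_inv (h.pr a (h.pr b c)), h.inv_pr, h.inv_pr b c,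
    h.pr_pr_eq (h.codO_inv c) (h.domO_inv a) (by rw [h.inv_inv]) rfl (h.inv_le _ _ hv)
      (h.inv_le _ _ hu) hvf' hue' hl' (hvf'.trans (h.dom_lam _ _ _ hl').symm)
      ((h.cod_lam _ _ _ hl').trans hue'.symm), h.inv_comp₃]
  refine h.comp₃_congr (h.inv_inv _).symm ?_ (h.inv_inv _).symm _ _ _ _
  exact (h.coherent _ _ _ hl).trans (h.inv_lam_inv _ _ _ hl).symm

theorem isRegularStar (h : D.IsChainedProjectionGroupoid) : IsRegularStar h.pr D.inv where
  mul_assoc := h.pr_assoc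
  star_star := h.inv_inv
  star_mul := h.inv_pr
  mul_star_mul := h.pr_inv_pr

end ChainedProjectionGroupoidData.IsChainedProjectionGroupoid

/-! ### Chained projection functors as `*`-homomorphisms. -/

namespace IsChainedProjectionFunctor

open OrderedGroupoidData

variable {G G' : Type u} {D : ChainedProjectionGroupoidData G}
  {D' : ChainedProjectionGroupoidData G'} {φ : G → G'}

theorem map_inv (h : D.IsGroupoid) (h' : D'.IsGroupoid) (hφ : IsChainedProjectionFunctor D D' φ)
    (a : G) : φ (D.inv a) = D'.inv (φ a) := by
  refine h'.eq_inv_of_comp_eq (by rw [← hφ.map_cod, ← hφ.map_dom, h.dom_inv]) ?_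
  rw [← hφ.map_comp a (D.inv a) (h.dom_inv a).symm, h.comp_inv]
  exact hφ.map_obj _ (h.dom_mem a)

theorem map_evalPair (h : D.IsWeakChainedProjectionGroupoid)
    (h' : D'.IsWeakChainedProjectionGroupoid) (hφ : IsChainedProjectionFunctor D D' φ)
    (p q : D.obj) (hpq : FRel D.th p q) :
    φ (h.evalPair p q hpq) = h'.evalPair ⟨φ p, hφ.map_obj p p.2⟩ ⟨φ q, hφ.map_obj q q.2⟩
      (FRel.map hφ.map_th hpq) :=
  hφ.map_eval _

/-- The images of the restricted factors lie below `φ a` and `φ b` and have the right range and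
domain, so `pr_eq` computes the product from them. -/
theorem map_pr (h : D.IsWeakChainedProjectionGroupoid)
    (h' : D'.IsWeakChainedProjectionGroupoid) (hφ : IsChainedProjectionFunctor D D' φ)
    (a b : G) : φ (h.pr a b) = h'.pr (φ a) (φ b) := by
  have h₁ := h.cod_rres a (D.th (h.codO a) (h.domO b)) (h.th_le _ _)
  have h₂ := h.dom_lres b (D.th (h.domO b) (h.codO a)) (h.th_le _ _)
  have h₃ := (hφ.map_cod _).symm.trans (congrArg φ h₁)
  have h₄ := (hφ.map_dom _).symm.trans (congrArg φ h₂)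
  rw [h'.pr_eq (p := ⟨φ (h.codO a), hφ.map_obj _ (h.codO a).2⟩)
    (q := ⟨φ (h.domO b), hφ.map_obj _ (h.domO b).2⟩) (Subtype.ext (hφ.map_cod a).symm)
    (Subtype.ext (hφ.map_dom b).symm) (hφ.map_th _ _) (hφ.map_th _ _)
    (FRel.map hφ.map_th (h.isProjectionAlgebra.fRel_th (h.codO a) (h.domO b)))
    (hφ.map_le _ _ (h.rres_le _ _ _)) (hφ.map_le _ _ (h.lres_le _ _ _)) h₃ h₄
    (by rw [h'.dom_evalPair]; exact h₃) (by rw [h'.cod_evalPair]; exact h₄.symm)]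
  refine (hφ.map_comp _ _ _).trans (comp_congr ?_ rfl _ _)
  exact (hφ.map_comp _ _ _).trans (comp_congr rfl (hφ.map_evalPair h h' _ _ _) _ _)

end IsChainedProjectionFunctor

end RegStar

namespace RegStar

/-! ### The two constructions are mutually inverse -/

/-- With `p = a*a` and `q = bb*`, the word is `a` followed by alternating `p` and `q` and then `b`;
idempotence of `pq` together with `ap = a` and `qb = b` leaves `ab`. -/
theorem RegularStarSemigroup.toData_pr_eq_mul {S : RegularStarSemigroup.{u}}
    (h : S.toData.IsWeakChainedProjectionGroupoid) (a b : S.carrier) : h.pr a b = a * b := by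
  change h.rres _ _ _ * h.evalPair _ _ _ * h.lres _ _ _ = _
  rw [lres_eq_of_isOrderedGroupoid, rres_eq_of_isOrderedGroupoid]
  erw [evalPair_eq, projTh_val, projTh_val]
  change a * (star a * a * (b * star b * (star a * a))) * _ *
    ((b * star b * (star a * a * (b * star b))) * b) = _
  change _ * ((star a * a * (b * star b * (star a * a))) *
    (b * star b * (star a * a * (b * star b)))) * _ = _
  have h1 := proj_mul_proj_idem_assoc ⟨_, star_mul_mem_proj a⟩ ⟨_, mul_star_mem_proj b⟩
  simp only [mul_assoc] at h1
  have h2 := congrArg (a * ·) (h1 b)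
  simp only [mul_star_mul_self_assoc, mul_star_mul_self] at h2
  simp only [mul_assoc, mul_star_mul_self, mul_star_mul_self_assoc, star_mul_mul_star_assoc, h2]

/-! ### Recovering a chained projection groupoid from its semigroup. -/

namespace ChainedProjectionGroupoidData

open OrderedGroupoidData

/-- Data on the same set are equal if the identity map is a functor that reflects objects and the
order. -/
theorem eq_of_isChainedProjectionFunctor {G : Type u} {D D' : ChainedProjectionGroupoidData G}
    (hid : IsChainedProjectionFunctor D D' fun a => a) (hobj : ∀ p ∈ D'.obj, p ∈ D.obj)
    (hle : ∀ a b, D'.le a b → D.le a b) (hinv : ∀ a, D.inv a = D'.inv a) : D = D' := by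
  obtain ⟨⟨⟨obj, dom, cod, comp, inv, le⟩, th⟩, eval⟩ := D
  obtain ⟨⟨⟨obj', dom', cod', comp', inv', le'⟩, th'⟩, eval'⟩ := D'
  -- The fields are identified in order of dependency: the type of `comp` involves `dom` and `cod`,
  -- that of `th` involves `obj`, and that of `eval` involves `th`.
  obtain rfl : obj = obj' := Set.Subset.antisymm hid.map_obj hobj
  obtain rfl : dom = dom' := funext hid.map_dom
  obtain rfl : cod = cod' := funext hid.map_cod
  obtain rfl : comp = comp' := by
    funext a b hab
    exact hid.map_comp a b hab
  obtain rfl : inv = inv' := funext hinv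
  obtain rfl : le = le' := by
    funext a b
    exact propext ⟨hid.map_le a b, hle a b⟩
  obtain rfl : th = th' := by
    funext p q
    exact hid.map_th q p
  obtain rfl : eval = eval' := by
    funext c
    exact (hid.map_eval c).trans (congrArg eval' (Chain.map_id _ c))
  rfl

namespace IsChainedProjectionGroupoid

variable {G : Type u} {D : ChainedProjectionGroupoidData G} (h : D.IsChainedProjectionGroupoid)
include h

/-- If `p² = p = p⁻¹` then `p = p • p⁻¹ = d(p)`, an identity. -/
theorem mem_proj_of_iff (hR : IsRegularStar h.pr D.inv) (p : G) :
    p ∈ (RegularStarSemigroup.of h.pr D.inv hR).proj ↔ p ∈ D.obj := by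
  change (h.pr p p = p ∧ D.inv p = p) ↔ _
  constructor
  · rintro ⟨h1, h2⟩
    have h3 := h.pr_inv p
    rw [h2, h1] at h3
    rw [h3]
    exact h.dom_mem p
  · intro hp
    have h1 : D.cod p = D.dom p := (h.cod_obj p hp).trans (h.dom_obj p hp).symm
    exact ⟨by rw [h.pr_eq_comp h1, h.comp_eq_left hp], h.inv_obj hp⟩

theorem inv_pr_self (a : G) : h.pr (D.inv a) a = D.cod a := by
  have h1 := h.pr_inv (D.inv a)
  rwa [h.inv_inv, h.dom_inv] at h1

/-- The element `q • p • q` is `(q • p) • (q • p)⁻¹`, the domain of `q • p`. The first factor of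
that product is `q` restricted to `pθ_q`, which is the object `pθ_q` itself. -/
theorem pr_pr_obj (p q : D.obj) : h.pr (h.pr q p) q = D.th q p := by
  have h1 : h.pr (p : G) p = p := ((h.mem_proj_of_iff h.isRegularStar p).2 p.2).1
  have h2 := h.pr_inv (h.pr q p)
  rw [h.inv_pr, h.inv_obj p.2, h.inv_obj q.2, h.pr_assoc, ← h.pr_assoc (p : G), h1,
    ← h.pr_assoc] at h2
  rw [h2]
  have h3 := h.rres_le q (D.th (h.codO q) (h.domO p)) (h.th_le _ _)
  have hc : h.codO q = q := Subtype.ext (h.cod_obj q q.2)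
  have hd : h.domO p = p := Subtype.ext (h.dom_obj p p.2)
  have h4 : D.dom (h.pr q p) = D.dom (h.rres q (D.th (h.codO q) (h.domO p)) (h.th_le _ _)) :=
    h.dom_comp₃ _ _
  have h5 : D.le (D.th q p) q := h.th_le _ _
  rw [h4, h.eq_of_le_of_cod_eq h3 h5 (by rw [h.cod_rres, h.cod_obj _ (D.th q p).2, hc, hd]),
    h.dom_obj _ (D.th q p).2]

/-- For `p ≤ d(a)` both middle projections equal `p`, so `p • a` is the restriction of `a` to `p`;
this recovers the order from the product. -/
theorem pr_obj_of_le {p a : G} (hp : p ∈ D.obj) (hpa : D.le p (D.dom a)) :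
    D.le (h.pr p a) a ∧ D.dom (h.pr p a) = p := by
  obtain ⟨u, ⟨hu, hd⟩, -⟩ := h.existsUnique_restriction a p hp hpa
  lift p to D.obj using hp
  have hc : h.codO p = p := Subtype.ext (h.cod_obj p p.2)
  have h1 : p = D.th (h.domO a) p := (h.le_iff_ple _ _).1 hpa
  have h2 : p = D.th p (h.domO a) :=
    h.isProjectionAlgebra.leF_of_leF_of_ple (h.fRel_self p).1 h1
  have h3 : h.pr p a = u := by
    rw [h.pr_eq hc rfl h2 h1 (h.fRel_self p) (h.le_refl _) hu (h.cod_obj p p.2) hd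
      (by rw [h.dom_evalPair, h.cod_obj p p.2]) (by rw [h.cod_evalPair, hd])]
    refine (h.comp₃_eq_comp_comp _ _).trans ((h.comp_eq_right p.2 _).trans ?_)
    refine (comp_congr (h.evalPair_self p _) rfl _ ?_).trans (h.comp_eq_right p.2 ?_)
    all_goals rw [h.cod_obj p p.2, hd]
  rw [h3]
  exact ⟨hu, hd⟩

theorem le_iff_exists_pr {a b : G} :
    D.le a b ↔ ∃ p ∈ D.obj, p = h.pr (h.pr (D.dom b) p) (D.dom b) ∧ a = h.pr p b := by
  have h1 (p : D.obj) : (p : G) = h.pr (h.pr (D.dom b) p) (D.dom b) ↔ D.le p (D.dom b) := by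
    rw [h.pr_pr_obj p (h.domO b), ← Subtype.ext_iff]
    exact (h.le_iff_ple p (h.domO b)).symm
  constructor
  · intro hab
    have h2 := h.dom_le _ _ hab
    refine ⟨D.dom a, h.dom_mem a, (h1 (h.domO a)).2 h2, ?_⟩
    obtain ⟨h3, h4⟩ := h.pr_obj_of_le (h.dom_mem a) h2
    exact h.eq_of_le_of_dom_eq hab h3 h4.symm
  · rintro ⟨p, hp, h2, rfl⟩
    exact (h.pr_obj_of_le hp ((h1 ⟨p, hp⟩).1 h2)).1

/-- For `p F q` nothing is restricted in `p • q`, so `ε[p, q] = p • q`; the remaining `q` is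
absorbed by the chain starting at `q`. -/
theorem eval_mk_cons (p q : D.obj) (l : List D.obj) (hc) (hc') :
    D.eval (Chain.mk ⟨p, q :: l, hc⟩) = h.pr p (D.eval (Chain.mk ⟨q, l, hc'⟩)) := by
  have hpq : FRel D.th p q := (List.isChain_cons_cons.1 hc).1
  have h1 := h.eval_comp (Chain.pair p q hpq) (Chain.mk ⟨q, l, hc'⟩) rfl
  have h2 : (Chain.pair p q hpq).comp (Chain.mk ⟨q, l, hc'⟩) rfl =
    Chain.mk ⟨p, q :: l, hc⟩ := Chain.mk_comp_mk _ _ _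
  rw [h2, ← h.pr_eq_comp] at h1
  have h3 : D.eval (Chain.pair p q hpq) = h.pr p q := by
    have h4 : D.cod p = D.dom (h.evalPair p q hpq) :=
      (h.cod_obj p p.2).trans (h.dom_evalPair _ _ _).symm
    have h5 : D.cod (h.evalPair p q hpq) = D.dom q :=
      (h.cod_evalPair _ _ _).trans (h.dom_obj q q.2).symm
    rw [h.pr_eq (p := p) (q := q) (Subtype.ext (h.cod_obj p p.2))
      (Subtype.ext (h.dom_obj q q.2)) hpq.1 hpq.2 hpq (h.le_refl _) (h.le_refl _)
      (h.cod_obj p p.2) (h.dom_obj q q.2) h4 h5]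
    exact ((h.comp_eq_left q.2 _).trans (h.comp_eq_right p.2 _)).symm
  have h6 := h.pr_dom_left (D.eval (Chain.mk ⟨q, l, hc'⟩))
  rw [h.dom_eval] at h6
  rw [h1, h3, h.pr_assoc]
  exact congrArg _ h6

theorem isChainedProjectionFunctor_toData_of (hR : IsRegularStar h.pr D.inv) :
    IsChainedProjectionFunctor D (RegularStarSemigroup.of h.pr D.inv hR).toData fun a => a where
  map_obj p hp := (h.mem_proj_of_iff hR p).2 hp
  map_dom a := (h.pr_inv a).symm
  map_cod a := (h.inv_pr_self a).symm
  map_comp a b hab := (h.pr_eq_comp hab).symm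
  map_le a b hab := by
    obtain ⟨p, hp, h1, h2⟩ := h.le_iff_exists_pr.1 hab
    refine ⟨p, (h.mem_proj_of_iff hR p).2 hp, ?_, h2⟩
    change p = h.pr (h.pr (h.pr b (D.inv b)) p) (h.pr b (D.inv b))
    rw [h.pr_inv]
    exact h1
  map_th p q := Subtype.ext (h.pr_pr_obj p q).symm
  map_eval c := by
    induction c using Quotient.inductionOn with
    | h c =>
      obtain ⟨p, l, hc⟩ := c
      induction l generalizing p with
      | nil => exact h.eval_single p
      | cons q l ih =>
        have hc' := (List.isChain_cons_cons.1 hc).2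
        refine (h.eval_mk_cons p q l hc hc').trans ((congrArg (h.pr p) (ih q hc')).trans ?_)
        exact ((RegularStarSemigroup.of h.pr D.inv hR).foldl_mul _ (p : G) (q : G)).symm

theorem toData_of_eq (hR : IsRegularStar h.pr D.inv) :
    (RegularStarSemigroup.of h.pr D.inv hR).toData = D := by
  refine (eq_of_isChainedProjectionFunctor (h.isChainedProjectionFunctor_toData_of hR)
    (fun p => (h.mem_proj_of_iff hR p).1) ?_ fun _ => rfl).symm
  rintro a b ⟨p, hp, h1, h2⟩
  refine h.le_iff_exists_pr.2 ⟨p, (h.mem_proj_of_iff hR p).1 hp, ?_, h2⟩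
  change p = h.pr (h.pr (h.pr b (D.inv b)) p) (h.pr b (D.inv b)) at h1
  rwa [h.pr_inv] at h1

end IsChainedProjectionGroupoid

end ChainedProjectionGroupoidData

/-! ### Equality of functors -/

theorem RegularStarSemigroup.of_eq (S : RegularStarSemigroup.{u})
    {mul : S.carrier → S.carrier → S.carrier} {st : S.carrier → S.carrier}
    (hmul : ∀ a b, mul a b = a * b) (hst : ∀ a, st a = star a) (h : IsRegularStar mul st) :
    RegularStarSemigroup.of mul st h = S := by
  obtain rfl : mul = fun a b => a * b := funext₂ hmul
  obtain rfl : st = star := funext hst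
  rfl

/-- The two hom-types agree only after the operations are identified. Keeping the operations as
variables lets them be substituted, after which equality of underlying maps suffices. -/
theorem RegularStarSemigroup.hom_of_heq {S T : RegularStarSemigroup.{u}}
    {mul : S.carrier → S.carrier → S.carrier} {st : S.carrier → S.carrier}
    {mul' : T.carrier → T.carrier → T.carrier} {st' : T.carrier → T.carrier}
    (hmul : ∀ a b, mul a b = a * b) (hst : ∀ a, st a = star a) (h : IsRegularStar mul st)
    (hmul' : ∀ a b, mul' a b = a * b) (hst' : ∀ a, st' a = star a) (h' : IsRegularStar mul' st')
    (φ : S ⟶ T) (ψ : RegularStarSemigroup.of mul st h ⟶ RegularStarSemigroup.of mul' st' h')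
    (hψ : ψ.toFun = φ.toFun) : HEq ψ φ := by
  obtain rfl : mul = fun a b => a * b := funext₂ hmul
  obtain rfl : st = star := funext hst
  obtain rfl : mul' = fun a b => a * b := funext₂ hmul'
  obtain rfl : st' = star := funext hst'
  exact heq_of_eq (RegularStarSemigroup.Hom.ext hψ)

theorem ChainedProjectionGroupoid.mk_eq (X : ChainedProjectionGroupoid.{u})
    {D : ChainedProjectionGroupoidData X.carrier} (hD : D = X.data)
    (h : D.IsChainedProjectionGroupoid) : ChainedProjectionGroupoid.mk X.carrier D h = X := by
  subst hD
  rfl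

theorem ChainedProjectionGroupoid.hom_mk_heq {X Y : ChainedProjectionGroupoid.{u}}
    {D : ChainedProjectionGroupoidData X.carrier} {D' : ChainedProjectionGroupoidData Y.carrier}
    (hD : D = X.data) (hD' : D' = Y.data) (h : D.IsChainedProjectionGroupoid)
    (h' : D'.IsChainedProjectionGroupoid) (φ : X ⟶ Y)
    (ψ : ChainedProjectionGroupoid.mk X.carrier D h ⟶ ChainedProjectionGroupoid.mk Y.carrier D' h')
    (hψ : ψ.toFun = φ.toFun) : HEq ψ φ := by
  subst hD hD'
  exact heq_of_eq (ChainedProjectionGroupoid.Hom.ext hψ)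

end RegStar

theorem theorem8p1 :
    ∃ (hG : ∀ S : RegStar.RegularStarSemigroup.{u}, S.toData.IsChainedProjectionGroupoid)
      (hG' : ∀ (S T : RegStar.RegularStarSemigroup.{u}) (φ : S ⟶ T),
        RegStar.IsChainedProjectionFunctor S.toData T.toData φ.toFun)
      (hS : ∀ X : RegStar.ChainedProjectionGroupoid.{u},
        RegStar.IsRegularStar X.pr X.data.inv)
      (hS' : ∀ (X Y : RegStar.ChainedProjectionGroupoid.{u}) (φ : X ⟶ Y),
        (∀ a b, φ.toFun (X.pr a b) = Y.pr (φ.toFun a) (φ.toFun b)) ∧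
          ∀ a, φ.toFun (X.data.inv a) = Y.data.inv (φ.toFun a)),
      ∃ e : IsoCat RegStar.RegularStarSemigroup.{u} RegStar.ChainedProjectionGroupoid.{u},
        e.functor = RegStar.functorG hG hG' ∧ e.inverse = RegStar.functorS hS hS' := by
  have hG := fun S : RegStar.RegularStarSemigroup.{u} => S.toData_isChainedProjectionGroupoid
  have hG' := fun (S T : RegStar.RegularStarSemigroup.{u}) (φ : S ⟶ T) =>
    RegStar.RegularStarSemigroup.isChainedProjectionFunctor_toFun φ
  have hS := fun X : RegStar.ChainedProjectionGroupoid.{u} =>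
    X.isChainedProjectionGroupoid.isRegularStar
  have hS' (X Y : RegStar.ChainedProjectionGroupoid.{u}) (φ : X ⟶ Y) :
      (∀ a b, φ.toFun (X.pr a b) = Y.pr (φ.toFun a) (φ.toFun b)) ∧
        ∀ a, φ.toFun (X.data.inv a) = Y.data.inv (φ.toFun a) :=
    ⟨φ.isChainedProjectionFunctor.map_pr
        X.isChainedProjectionGroupoid.toIsWeakChainedProjectionGroupoid
        Y.isChainedProjectionGroupoid.toIsWeakChainedProjectionGroupoid,
      φ.isChainedProjectionFunctor.map_inv
        X.isChainedProjectionGroupoid.toIsGroupoid Y.isChainedProjectionGroupoid.toIsGroupoid⟩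
  -- The two remaining goals are the strict equalities of the composite functors with the
  -- identities.
  refine ⟨hG, hG', hS, hS', ⟨RegStar.functorG hG hG', RegStar.functorS hS hS', ?_, ?_⟩, rfl, rfl⟩
  · have h1 (S : RegStar.RegularStarSemigroup.{u}) :=
      RegStar.RegularStarSemigroup.toData_pr_eq_mul
        (S.toData_isChainedProjectionGroupoid.toIsWeakChainedProjectionGroupoid)
    refine (Functor.hext (fun S => ?_) fun S T φ => ?_).symm
    · exact S.of_eq (h1 S) (fun _ => rfl) (hS ⟨S.carrier, S.toData, hG S⟩)
    · exact RegStar.RegularStarSemigroup.hom_of_heq (h1 S) (fun _ => rfl)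
        (hS ⟨S.carrier, S.toData, hG S⟩) (h1 T) (fun _ => rfl) (hS ⟨T.carrier, T.toData, hG T⟩) φ _ rfl
  · have h1 (X : RegStar.ChainedProjectionGroupoid.{u}) :=
      X.isChainedProjectionGroupoid.toData_of_eq (hS X)
    refine Functor.hext (fun X => ?_) fun X Y φ => ?_
    · exact X.mk_eq (h1 X) (hG (.of _ _ (hS X)))
    · exact RegStar.ChainedProjectionGroupoid.hom_mk_heq (h1 X) (h1 Y)
        (hG (.of _ _ (hS X))) (hG (.of _ _ (hS Y))) φ _ rfl
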